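/- Let $E$ be a rearrangement invariant (r.i.) function space on $[0,1]$ with Lebesgue measure $\lambda$. That is, $E$ is a real Banach space of (a.e.-equivalence classes of) integrable functions $f:[0,1]\to\mathbb{R}$ such that: $E$ contains the characteristic functions of all measurable sets; if $g\in E$ and $f$ is measurable with $|f|\le|g|$ a.e., then $f\in E$ and $\|f\|_E\le\|g\|_E$; and if $g\in E$ and $f$ is measurable with $\lambda(\{|f|>t\})=\lambda(\{|g|>t\})$ for all $t\ge 0$, then $f\in E$ and $\|f\|_E=\|g\|_E$. Call a bounded linear operator $T:E\to E$ strictly singular if there is no infinite-dimensional subspace $M\subseteq E$ on which $T$ is bounded below (i.e. $\|Tx\|\ge c\|x\|$ for all $x\in M$ and some $c>0$), and say that $E$ has the Kato property if the strictly singular operators $E\to E$ are exactly the compact operators $E\to E$. If $E$ is not reflexive, then $E$ fails to have the Kato property; more precisely, there is a strictly singular operator $T:E\to E$ which is not compact. -/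

import Mathlib

open MeasureTheory

/-- A real normed space is reflexive if the canonical embedding into its bidual is onto. -/
def IsReflexiveSpace (X : Type*) [NormedAddCommGroup X] [NormedSpace ℝ X] : Prop :=
  Function.Surjective (NormedSpace.inclusionInDoubleDual ℝ X)

/-- A bounded operator is strictly singular if it is not invertible (that is, not bounded below)
on any infinite dimensional subspace. -/
def IsStrictlySingular {X Y : Type*} [NormedAddCommGroup X] [NormedSpace ℝ X]
    [NormedAddCommGroup Y] [NormedSpace ℝ Y] (T : X →L[ℝ] Y) : Prop :=
  ∀ M : Submodule ℝ X, ¬ FiniteDimensional ℝ M →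
    ¬ ∃ c : ℝ, 0 < c ∧ ∀ x ∈ M, c * ‖x‖ ≤ ‖T x‖

/-- The Kato property: the strictly singular endomorphisms are exactly the compact ones. -/
def HasKatoProperty (X : Type*) [NormedAddCommGroup X] [NormedSpace ℝ X] : Prop :=
  {T : X →L[ℝ] X | IsStrictlySingular T} = {T : X →L[ℝ] X | IsCompactOperator T}

/-- `f` and `g` on `[0,1]` are equimeasurable: `|f|` and `|g|` have the same distribution
function with respect to Lebesgue measure. -/
def Equimeasurable (f g : unitInterval → ℝ) : Prop :=
  ∀ t : ℝ, 0 ≤ t → volume {x | t < |f x|} = volume {x | t < |g x|}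

/-- The linear map `ι` exhibits the normed space `E` (complete, in the applications) as a
rearrangement invariant function space on `[0,1]` with Lebesgue measure: `ι` identifies `E` with a
linear space of a.e.-classes of real measurable functions. -/
structure IsRIFunctionSpace {E : Type*} [NormedAddCommGroup E] [NormedSpace ℝ E]
    (ι : E →ₗ[ℝ] (unitInterval →ₘ[(volume : Measure unitInterval)] ℝ)) : Prop where
  /-- the elements of `E` are determined by their functions -/
  injective : Function.Injective ι
  /-- all functions in `E` are integrable -/
  integrable : ∀ f : E, Integrable (ι f) volume
  /-- the characteristic functions of all measurable sets belong to `E` -/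
  indicator_mem : ∀ A : Set unitInterval, MeasurableSet A →
    ∃ e : E, ι e =ᵐ[volume] A.indicator (fun _ => (1 : ℝ))
  /-- `E` is an ideal of measurable functions and its norm is a lattice norm -/
  ideal : ∀ (g : E) (f : unitInterval →ₘ[(volume : Measure unitInterval)] ℝ),
    (∀ᵐ x, |f x| ≤ |ι g x|) → ∃ f' : E, ι f' = f ∧ ‖f'‖ ≤ ‖g‖
  /-- membership in `E` and the norm depend only on the distribution function of `|f|` -/
  rearrangement : ∀ (g : E) (f : unitInterval →ₘ[(volume : Measure unitInterval)] ℝ),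
    Equimeasurable f (ι g) → ∃ f' : E, ι f' = f ∧ ‖f'‖ = ‖g‖

open Filter Topology Set

/-! The argument is about solid Banach function spaces with L^∞ ⊆ E ⊆ L¹. Two configurations each
produce a strictly singular noncompact operator; in the absence of both, E is reflexive. Both
operators use a bounded orthonormal system (r_k), here the cosines.

c₀ case (`HasBoundedPositiveSeries`): positive u_k, bounded away from 0, with bounded partial sums.
Put T x = Σ (∫ x r_k) u_k, which factors through E → L¹ → c₀ → E. If T were bounded below on an
infinite-dimensional subspace, a gliding hump there would give unit vectors whose signed sums have
bounded c₀ coordinates, hence bounded norm. By the Orlicz property of L¹ their L¹ norms would sum to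
O(√n), yet these norms are bounded below. T is not compact since it maps r_k to u_k.

ℓ¹ case: E is order continuous and x ↦ (g_k x) is bounded into ℓ¹ with ‖g_k‖ bounded below. Put T x
= Σ g_k(x) r_k. Long sums of gliding hump vectors, normalised in ℓ¹, have uniformly small
coordinates. Their images are uniformly bounded and small in L² by Bessel, hence small in E by order
continuity. T is not compact because pairing with r_k recovers g_k.

Neither case: without a c₀ series, increasing norm bounded sequences converge, so E is order
continuous and, by Radon-Nikodym, its functionals are functions. Without ℓ¹ coordinates this Köthe
dual is order continuous as well, so elements of the bidual are functions k. The truncations of |k|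
increase with bounded norm, so they converge in E; by solidity k lies in E
(`IsFunctionSpace.isReflexiveSpace`). -/

/-- A relation `R x f`, read "the vector `x` is represented by the function `f`", which makes part
of the normed space `X` a solid normed space of real functions on a measure space, containing the
constants. -/
structure IsSolidRepresentation {Ω X : Type*} [MeasurableSpace Ω] (μ : Measure Ω)
    [NormedAddCommGroup X] [NormedSpace ℝ X] (R : X → (Ω → ℝ) → Prop) : Prop where
  aestronglyMeasurable : ∀ {x f}, R x f → AEStronglyMeasurable f μ
  congr : ∀ {x f g}, R x f → f =ᵐ[μ] g → R x g
  add : ∀ {x y f g}, R x f → R y g → R (x + y) (fun ω => f ω + g ω)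
  smul : ∀ {x f} (c : ℝ), R x f → R (c • x) (fun ω => c * f ω)
  unique : ∀ {x y f}, R x f → R y f → x = y
  solid : ∀ {x f g}, R x f → AEStronglyMeasurable g μ → (∀ᵐ ω ∂μ, |g ω| ≤ |f ω|) →
    ∃ y, R y g ∧ ‖y‖ ≤ ‖x‖
  one : ∃ x, R x (fun _ => 1)

/-! ### Solid spaces, order continuity, and set functions induced by functionals -/

namespace IsSolidRepresentation

variable {Ω X : Type*} [MeasurableSpace Ω] {μ : Measure Ω} [NormedAddCommGroup X] [NormedSpace ℝ X]
  {R : X → (Ω → ℝ) → Prop}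

theorem norm_mono (h : IsSolidRepresentation μ R) {x y : X} {f g : Ω → ℝ} (hx : R x f)
    (hy : R y g) (hfg : ∀ᵐ ω ∂μ, |f ω| ≤ |g ω|) : ‖x‖ ≤ ‖y‖ := by
  obtain ⟨z, hz, hzn⟩ := h.solid hy (h.aestronglyMeasurable hx) hfg
  rwa [h.unique hx hz]

theorem sub (h : IsSolidRepresentation μ R) {x y : X} {f g : Ω → ℝ} (hx : R x f) (hy : R y g) :
    R (x - y) (fun ω => f ω - g ω) := by
  have := h.add hx (h.smul (-1) hy)
  simpa [sub_eq_add_neg] using this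

theorem zero (h : IsSolidRepresentation μ R) : R 0 (fun _ => 0) := by
  obtain ⟨x, hx⟩ := h.one
  simpa using h.smul 0 hx

theorem sum (h : IsSolidRepresentation μ R) {κ : Type*} (s : Finset κ) {x : κ → X}
    {f : κ → Ω → ℝ} (hx : ∀ i ∈ s, R (x i) (f i)) :
    R (∑ i ∈ s, x i) (fun ω => ∑ i ∈ s, f i ω) := by
  classical
  induction s using Finset.induction_on with
  | empty => simpa using h.zero
  | insert a s ha ih =>
    simp only [Finset.sum_insert ha]
    exact h.add (hx a (by simp)) (ih fun i hi => hx i (by simp [hi]))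

theorem eq_zero (h : IsSolidRepresentation μ R) {x : X} {f : Ω → ℝ} (hx : R x f)
    (hf : f =ᵐ[μ] fun _ => 0) : x = 0 :=
  h.unique (h.congr hx hf) h.zero

/-- Bounded functions are represented, with control of the norm. -/
theorem bounded (h : IsSolidRepresentation μ R) {e : X} (he : R e (fun _ => 1)) {f : Ω → ℝ}
    (hf : AEStronglyMeasurable f μ) {C : ℝ} (hC : 0 ≤ C) (hfC : ∀ᵐ ω ∂μ, |f ω| ≤ C) :
    ∃ x, R x f ∧ ‖x‖ ≤ C * ‖e‖ := by
  obtain ⟨y, hy, hyn⟩ := h.solid (h.smul C he) hf (by simpa [abs_of_nonneg hC] using hfC)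
  exact ⟨y, hy, hyn.trans_eq (by simp [norm_smul, abs_of_nonneg hC])⟩

theorem norm_le_of_bounded (h : IsSolidRepresentation μ R) {e : X} (he : R e (fun _ => 1))
    {x : X} {f : Ω → ℝ} (hx : R x f) {C : ℝ} (hC : 0 ≤ C) (hfC : ∀ᵐ ω ∂μ, |f ω| ≤ C) :
    ‖x‖ ≤ C * ‖e‖ := by
  obtain ⟨y, hy, hyn⟩ := h.bounded he (h.aestronglyMeasurable hx) hC hfC
  rwa [h.unique hx hy]

theorem indicator (h : IsSolidRepresentation μ R) {x : X} {f : Ω → ℝ} (hx : R x f) {A : Set Ω}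
    (hA : MeasurableSet A) : ∃ y, R y (A.indicator f) := by
  obtain ⟨y, hy, -⟩ := h.solid hx ((h.aestronglyMeasurable hx).indicator hA)
    (Eventually.of_forall fun ω => by
      by_cases hω : ω ∈ A <;> simp [hω])
  exact ⟨y, hy⟩

/-- Order continuity of the norm, along decreasing sequences of sets with empty intersection. -/
def OrderContinuous (R : X → (Ω → ℝ) → Prop) : Prop :=
  ∀ (x : X) (f : Ω → ℝ), R x f → ∀ A : ℕ → Set Ω, (∀ n, MeasurableSet (A n)) → Antitone A →
    ⋂ n, A n = ∅ → ∀ y : ℕ → X, (∀ n, R (y n) ((A n).indicator f)) →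
      Tendsto (fun n => ‖y n‖) atTop (𝓝 0)

/-- After a finite set of indices containing 0, …, n-1, the remainder is dominated by |f| on the
union of the B i with i ≥ n. These tails decrease to ∅ by disjointness, so order continuity gives
unconditional convergence. -/
theorem hasSum_indicator (h : IsSolidRepresentation μ R) (hoc : OrderContinuous R) {x : X}
    {f : Ω → ℝ} {B : ℕ → Set Ω} (hB : ∀ n, MeasurableSet (B n)) (hd : Pairwise (Function.onFun Disjoint B))
    (hx : R x ((⋃ n, B n).indicator f)) (hxf : ∃ x', R x' f) {y : ℕ → X}
    (hy : ∀ n, R (y n) ((B n).indicator f)) :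
    HasSum y x := by
  obtain ⟨x', hx'⟩ := hxf
  let A : ℕ → Set Ω := fun n => ⋃ i ∈ Set.Ici n, B i
  have hA : ∀ n, MeasurableSet (A n) := fun n =>
    MeasurableSet.biUnion (Set.to_countable _) fun i _ => hB i
  have hAa : Antitone A := fun m n hmn =>
    Set.biUnion_subset_biUnion_left (Set.Ici_subset_Ici.2 hmn)
  have hAe : ⋂ n, A n = ∅ := by
    ext ω
    simp only [Set.mem_iInter, Set.mem_empty_iff_false, iff_false, not_forall]
    by_cases hω : ∃ i, ω ∈ B i
    · obtain ⟨i, hi⟩ := hω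
      refine ⟨i + 1, fun hc => ?_⟩
      simp only [A, Set.mem_iUnion, Set.mem_Ici] at hc
      obtain ⟨j, hj, hjω⟩ := hc
      exact Set.disjoint_left.1 (hd (show i ≠ j by omega)) hi hjω
    · push Not at hω
      exact ⟨0, by simp [A, hω]⟩
  choose z hz using fun n => h.indicator hx' (hA n)
  have hlim := hoc x' f hx' A hA hAa hAe z hz
  rw [HasSum, SummationFilter.unconditional_filter, Metric.tendsto_atTop]
  intro ε hε
  obtain ⟨n, hn⟩ := (hlim.eventually (gt_mem_nhds hε)).exists
  refine ⟨Finset.range n, fun s hs => ?_⟩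
  rw [dist_comm, dist_eq_norm]
  refine lt_of_le_of_lt ?_ hn
  refine h.norm_mono (h.sub hx (h.sum s fun i _ => hy i)) (hz n) (Eventually.of_forall fun ω => ?_)
  by_cases hω : ∃ i, ω ∈ B i
  · obtain ⟨i, hi⟩ := hω
    have hne : ∀ j, j ≠ i → ω ∉ B j := fun j hj hjω => Set.disjoint_left.1 (hd hj) hjω hi
    rw [Set.indicator_of_mem (Set.mem_iUnion.2 ⟨i, hi⟩)]
    by_cases his : i ∈ s
    · rw [Finset.sum_eq_single_of_mem i his
        (fun j _ hj => Set.indicator_of_notMem (hne j hj) _), Set.indicator_of_mem hi]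
      simp
    · rw [Finset.sum_eq_zero (fun j hj => Set.indicator_of_notMem
        (hne j (fun hji => his (hji ▸ hj))) _)]
      have : n ≤ i := by
        by_contra hc
        exact his (hs (Finset.mem_range.2 (not_le.1 hc)))
      rw [Set.indicator_of_mem (by simp only [A, Set.mem_iUnion]; exact ⟨i, this, hi⟩)]
      simp
  · push Not at hω
    rw [Set.indicator_of_notMem (by simpa using hω),
      Finset.sum_eq_zero (fun j _ => Set.indicator_of_notMem (hω j) _)]
    simp

open Classical in
/-- A functional on an order continuous space has an integrable density on the bounded
functions: the density of the countably additive set function that it induces. -/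
theorem exists_density_indicator [IsFiniteMeasure μ] (h : IsSolidRepresentation μ R)
    (hoc : OrderContinuous R) (F : X →L[ℝ] ℝ) :
    ∃ k : Ω → ℝ, Measurable k ∧ Integrable k μ ∧ ∀ A, MeasurableSet A → ∀ x,
      R x (A.indicator fun _ => 1) → F x = ∫ ω in A, k ω ∂μ := by
  obtain ⟨e, he⟩ := h.one
  have hex : ∀ A : Set Ω, ∃ x, MeasurableSet A → R x (A.indicator fun _ => 1) := fun A => by
    by_cases hA : MeasurableSet A
    · obtain ⟨x, hx⟩ := h.indicator he hA
      exact ⟨x, fun _ => hx⟩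
    · exact ⟨0, fun hc => absurd hc hA⟩
  choose v hv using hex
  -- The set function A ↦ F(1_A) is countably additive by order continuity and vanishes on null
  -- sets, so Radon-Nikodym provides the density.
  let m : SignedMeasure Ω :=
    { measureOf' := fun A => if MeasurableSet A then F (v A) else 0
      empty' := by
        rw [if_pos MeasurableSet.empty, h.eq_zero (hv ∅ MeasurableSet.empty) (by simp), map_zero]
      not_measurable' := fun A hA => if_neg hA
      m_iUnion' := fun B hB hd => by
        rw [if_pos (MeasurableSet.iUnion hB)]
        simp only [if_pos (hB _)]
        exact F.hasSum (h.hasSum_indicator hoc hB hd (hv _ (MeasurableSet.iUnion hB)) ⟨e, he⟩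
          fun n => hv _ (hB n)) }
  have hm : ∀ A, MeasurableSet A → m A = F (v A) := fun A hA => if_pos hA
  have hac : m ≪ᵥ μ.toENNRealVectorMeasure := by
    refine VectorMeasure.AbsolutelyContinuous.mk fun A hA hA0 => ?_
    rw [Measure.toENNRealVectorMeasure_apply_measurable hA] at hA0
    rw [hm A hA, h.eq_zero (hv A hA) ?_, map_zero]
    filter_upwards [measure_eq_zero_iff_ae_notMem.1 hA0] with ω hω
    simp [hω]
  refine ⟨m.rnDeriv μ, m.measurable_rnDeriv μ, m.integrable_rnDeriv μ, fun A hA x hx => ?_⟩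
  rw [h.unique hx (hv A hA), ← hm A hA, ← withDensityᵥ_apply (m.integrable_rnDeriv μ) hA,
    SignedMeasure.withDensityᵥ_rnDeriv_eq m μ hac]

end IsSolidRepresentation

/-! ### Integral representation of functionals -/

/-- Bounded measurable functions are uniform limits of simple functions. -/
theorem exists_simpleFunc_abs_sub_le {Ω : Type*} [MeasurableSpace Ω] {f : Ω → ℝ}
    (hf : Measurable f) {C : ℝ} (hC : ∀ ω, |f ω| ≤ C) {ε : ℝ} (hε : 0 < ε) :
    ∃ φ : SimpleFunc Ω ℝ, ∀ ω, |f ω - φ ω| ≤ ε := by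
  -- Round down to multiples of ε; boundedness leaves only finitely many values.
  let p : Ω → ℤ := fun ω => ⌊f ω / ε⌋
  have hp : Measurable p := (hf.div_const ε).floor
  have hfin : (Set.range p).Finite := by
    refine (Set.finite_Icc ⌊-C / ε⌋ ⌊C / ε⌋).subset ?_
    rintro _ ⟨ω, rfl⟩
    have := abs_le.1 (hC ω)
    exact ⟨Int.floor_mono (by gcongr; exact this.1), Int.floor_mono (by gcongr; exact this.2)⟩
  let ψ : SimpleFunc Ω ℤ := ⟨p, fun n => hp (measurableSet_singleton n), hfin⟩
  refine ⟨ψ.map fun n : ℤ => ε * (n : ℝ), fun ω => ?_⟩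
  have h1 := Int.floor_le (f ω / ε)
  have h2 := Int.lt_floor_add_one (f ω / ε)
  have h3 : f ω = ε * (f ω / ε) := by field_simp
  have h4 : (ψ.map fun n : ℤ => ε * (n : ℝ)) ω = ε * (⌊f ω / ε⌋ : ℝ) := rfl
  rw [h4, abs_le]
  constructor <;> nlinarith

namespace IsSolidRepresentation

variable {Ω X : Type*} [MeasurableSpace Ω] {μ : Measure Ω} [NormedAddCommGroup X] [NormedSpace ℝ X]
  {R : X → (Ω → ℝ) → Prop}

theorem apply_simpleFunc_eq_integral [IsFiniteMeasure μ] (h : IsSolidRepresentation μ R)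
    (F : X →L[ℝ] ℝ) {k : Ω → ℝ} (hk : Integrable k μ)
    (hind : ∀ A, MeasurableSet A → ∀ x, R x (A.indicator fun _ => 1) → F x = ∫ ω in A, k ω ∂μ)
    (φ : SimpleFunc Ω ℝ) : ∃ x, R x φ ∧ F x = ∫ ω, φ ω * k ω ∂μ := by
  obtain ⟨e, he⟩ := h.one
  have hint : ∀ φ : SimpleFunc Ω ℝ, Integrable (fun ω => φ ω * k ω) μ := fun φ => by
    obtain ⟨C, hC⟩ := φ.exists_forall_norm_le
    exact hk.bdd_mul φ.aestronglyMeasurable (Eventually.of_forall hC)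
  induction φ using SimpleFunc.induction with
  | @const c s hs =>
    obtain ⟨x, hx⟩ := h.indicator he hs
    refine ⟨c • x, h.congr (h.smul c hx) (Eventually.of_forall fun ω => ?_), ?_⟩
    · by_cases hω : ω ∈ s <;> simp [hω]
    · rw [map_smul, hind s hs x hx, smul_eq_mul, ← integral_const_mul, ← integral_indicator hs]
      congr 1
      ext ω
      by_cases hω : ω ∈ s <;> simp [hω]
  | @add f g _ hf hg =>
    obtain ⟨x, hx, hFx⟩ := hf
    obtain ⟨y, hy, hFy⟩ := hg
    refine ⟨x + y, h.add hx hy, ?_⟩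
    rw [map_add, hFx, hFy, ← integral_add (hint f) (hint g)]
    congr 1
    ext ω
    simp [add_mul]

/-- Both sides are continuous for uniform convergence: F because the norm is a lattice norm and
constants are represented, the integral because k is integrable. Simple functions therefore suffice.
-/
theorem apply_bounded_eq_integral [IsFiniteMeasure μ] (h : IsSolidRepresentation μ R)
    (F : X →L[ℝ] ℝ) {k : Ω → ℝ} (hk : Integrable k μ)
    (hind : ∀ A, MeasurableSet A → ∀ x, R x (A.indicator fun _ => 1) → F x = ∫ ω in A, k ω ∂μ)
    {x : X} {f : Ω → ℝ} (hx : R x f) (hf : Measurable f) {C : ℝ} (hC : ∀ ω, |f ω| ≤ C) :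
    F x = ∫ ω, f ω * k ω ∂μ := by
  obtain ⟨e, he⟩ := h.one
  have hfk : Integrable (fun ω => f ω * k ω) μ :=
    hk.bdd_mul hf.aestronglyMeasurable (Eventually.of_forall hC)
  set K := ‖F‖ * ‖e‖ + ∫ ω, |k ω| ∂μ with hK
  have hK0 : 0 ≤ K := add_nonneg (by positivity) (integral_nonneg fun _ => abs_nonneg _)
  have key : ∀ ε : ℝ, 0 < ε → |F x - ∫ ω, f ω * k ω ∂μ| ≤ ε * K := by
    intro ε hε
    obtain ⟨φ, hφ⟩ := exists_simpleFunc_abs_sub_le hf hC hε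
    obtain ⟨y, hy, hFy⟩ := h.apply_simpleFunc_eq_integral F hk hind φ
    obtain ⟨D, hD⟩ := φ.exists_forall_norm_le
    have hφk : Integrable (fun ω => φ ω * k ω) μ :=
      hk.bdd_mul φ.aestronglyMeasurable (Eventually.of_forall hD)
    have h1 : |F x - F y| ≤ ε * (‖F‖ * ‖e‖) := by
      rw [← map_sub]
      refine (F.le_opNorm _).trans ?_
      have := h.norm_le_of_bounded he (h.sub hx hy) hε.le (Eventually.of_forall hφ)
      calc ‖F‖ * ‖x - y‖ ≤ ‖F‖ * (ε * ‖e‖) := by gcongr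
        _ = _ := by ring
    have h2 : |∫ ω, φ ω * k ω ∂μ - ∫ ω, f ω * k ω ∂μ| ≤ ε * ∫ ω, |k ω| ∂μ := by
      rw [← integral_sub hφk hfk, ← integral_const_mul, ← Real.norm_eq_abs]
      refine norm_integral_le_of_norm_le (hk.abs.const_mul ε) (Eventually.of_forall fun ω => ?_)
      rw [← sub_mul, Real.norm_eq_abs, abs_mul, abs_sub_comm]
      exact mul_le_mul_of_nonneg_right (hφ ω) (abs_nonneg _)
    calc |F x - ∫ ω, f ω * k ω ∂μ|
        = |(F x - F y) + (∫ ω, φ ω * k ω ∂μ - ∫ ω, f ω * k ω ∂μ)| := by rw [hFy]; ring_nf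
      _ ≤ ε * (‖F‖ * ‖e‖) + ε * ∫ ω, |k ω| ∂μ := (abs_add_le _ _).trans (add_le_add h1 h2)
      _ = ε * K := by rw [hK]; ring
  have h0 : |F x - ∫ ω, f ω * k ω ∂μ| ≤ 0 := by
    refine ge_of_tendsto (x := 𝓝[>] (0 : ℝ)) (f := fun ε => ε * K) ?_ ?_
    · have : Tendsto (fun ε : ℝ => ε * K) (𝓝 0) (𝓝 (0 * K)) := tendsto_id.mul_const K
      rw [zero_mul] at this
      exact this.mono_left nhdsWithin_le_nhds
    · filter_upwards [self_mem_nhdsWithin] with ε hε using key ε hε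
  exact sub_eq_zero.1 (abs_eq_zero.1 (le_antisymm h0 (abs_nonneg _)))

/-- A measurable function is bounded off each of a decreasing sequence of sets with empty
intersection. -/
theorem exists_antitone_bounded_off {f : Ω → ℝ} (hf : Measurable f) :
    ∃ A : ℕ → Set Ω, (∀ n, MeasurableSet (A n)) ∧ Antitone A ∧ ⋂ n, A n = ∅ ∧
      ∀ n ω, ω ∉ A n → |f ω| ≤ n := by
  refine ⟨fun n => {ω | (n : ℝ) < |f ω|}, fun n => measurableSet_lt measurable_const hf.abs,
    fun m n hmn ω (hω : (n : ℝ) < |f ω|) => ?_, ?_, fun n ω hω => not_lt.1 hω⟩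
  · exact lt_of_le_of_lt (Nat.cast_le.2 hmn) hω
  · refine Set.eq_empty_of_forall_notMem fun ω hω => ?_
    obtain ⟨n, hn⟩ := exists_nat_ge |f ω|
    have : (n : ℝ) < |f ω| := Set.mem_iInter.1 hω n
    exact absurd this hn.not_gt

/-- Multiplication by such a sign does not increase a solid norm, and it turns a pairing with k into
an integral of absolute values. -/
theorem exists_measurable_sign {k : Ω → ℝ} (hk : Measurable k) :
    ∃ s : Ω → ℝ, Measurable s ∧ (∀ ω, |s ω| ≤ 1) ∧ ∀ ω, s ω * k ω = |k ω| := by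
  refine ⟨fun ω => if 0 ≤ k ω then 1 else -1, Measurable.ite (measurableSet_le measurable_const hk)
    measurable_const measurable_const, fun ω => ?_, fun ω => ?_⟩
  · dsimp only
    split_ifs <;> simp
  · dsimp only
    split_ifs with h0
    · rw [one_mul, abs_of_nonneg h0]
    · rw [neg_one_mul, abs_of_neg (not_le.1 h0)]

/-- Functionals on an order continuous solid space of functions are given by integration
against a function. -/
theorem exists_density [IsFiniteMeasure μ] (h : IsSolidRepresentation μ R)
    (hoc : OrderContinuous R) (F : X →L[ℝ] ℝ) :
    ∃ k : Ω → ℝ, Measurable k ∧ Integrable k μ ∧ ∀ x f, R x f →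
      Integrable (fun ω => f ω * k ω) μ ∧ F x = ∫ ω, f ω * k ω ∂μ := by
  obtain ⟨k, hkm, hk, hind⟩ := h.exists_density_indicator hoc F
  refine ⟨k, hkm, hk, fun x f₀ hx₀ => ?_⟩
  obtain ⟨f, hfs, hff⟩ := h.aestronglyMeasurable hx₀
  have hf : Measurable f := hfs.measurable
  have hx : R x f := h.congr hx₀ hff
  suffices hs : Integrable (fun ω => f ω * k ω) μ ∧ F x = ∫ ω, f ω * k ω ∂μ by
    have he : (fun ω => f₀ ω * k ω) =ᵐ[μ] fun ω => f ω * k ω := by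
      filter_upwards [hff] with ω hω
      rw [hω]
    rw [integrable_congr he, integral_congr_ae he]
    exact hs
  obtain ⟨A, hA, hAa, hAe, hAf⟩ := exists_antitone_bounded_off hf
  obtain ⟨s, hs, hs1, hsk⟩ := exists_measurable_sign hkm
  have hbd : ∀ n ω, |(A n)ᶜ.indicator f ω| ≤ n := fun n ω => by
    by_cases hω : ω ∈ A n
    · simp [hω]
    · rw [Set.indicator_of_mem hω]
      exact hAf n ω hω
  have hle : ∀ n ω, |(A n)ᶜ.indicator f ω| ≤ |f ω| := fun n ω => by
    by_cases hω : ω ∈ A n <;> simp [hω]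
  have hev : ∀ ω, ∀ᶠ n in atTop, (A n)ᶜ.indicator f ω = f ω := fun ω => by
    have : ω ∉ ⋂ n, A n := by rw [hAe]; simp
    simp only [Set.mem_iInter, not_forall] at this
    obtain ⟨n, hn⟩ := this
    filter_upwards [eventually_ge_atTop n] with m hm
    exact Set.indicator_of_mem (show ω ∈ (A m)ᶜ from fun hc => hn (hAa hm hc)) _
  -- Testing F on the truncations of |f| times sgn k bounds ∫ |f_n k| by ‖F‖‖x‖ for every n; Fatou
  -- passes the bound to f k.
  have hint : Integrable (fun ω => f ω * k ω) μ := by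
    have hbound : ∀ n, ∫ ω, |(A n)ᶜ.indicator f ω * k ω| ∂μ ≤ ‖F‖ * ‖x‖ := by
      intro n
      let q : Ω → ℝ := fun ω => |(A n)ᶜ.indicator f ω| * s ω
      have hq : Measurable q := (hf.indicator (hA n).compl).abs.mul hs
      have hqle : ∀ ω, |q ω| ≤ |(A n)ᶜ.indicator f ω| := fun ω => by
        simp only [q, abs_mul, abs_abs]
        exact mul_le_of_le_one_right (abs_nonneg _) (hs1 ω)
      obtain ⟨y, hy, hyn⟩ := h.solid hx hq.aestronglyMeasurable
        (Eventually.of_forall fun ω => (hqle ω).trans (hle n ω))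
      have hFy := h.apply_bounded_eq_integral F hk hind hy hq (fun ω => (hqle ω).trans (hbd n ω))
      have : ∀ ω, q ω * k ω = |(A n)ᶜ.indicator f ω * k ω| := fun ω => by
        simp only [q, mul_assoc, abs_mul, hsk]
      simp only [this] at hFy
      rw [← hFy]
      exact (le_abs_self _).trans ((F.le_opNorm y).trans (by gcongr))
    have hi : ∀ n, Integrable (fun ω => (A n)ᶜ.indicator f ω * k ω) μ := fun n =>
      hk.bdd_mul (hf.indicator (hA n).compl).aestronglyMeasurable (Eventually.of_forall (hbd n))
    refine ⟨(hf.mul hkm).aestronglyMeasurable, ?_⟩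
    rw [HasFiniteIntegral]
    refine lt_of_le_of_lt ?_ (ENNReal.ofReal_lt_top (r := ‖F‖ * ‖x‖))
    have hfat : ∫⁻ ω, ‖f ω * k ω‖ₑ ∂μ
        ≤ liminf (fun n => ∫⁻ ω, ‖(A n)ᶜ.indicator f ω * k ω‖ₑ ∂μ) atTop := by
      refine le_trans (lintegral_mono fun ω => ?_) (lintegral_liminf_le fun n =>
        ((hf.indicator (hA n).compl).mul hkm).enorm)
      have : Tendsto (fun n => ‖(A n)ᶜ.indicator f ω * k ω‖ₑ) atTop (𝓝 ‖f ω * k ω‖ₑ) :=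
        tendsto_const_nhds.congr' ((hev ω).mono fun n hn => by simp only [hn])
      exact this.liminf_eq.ge
    refine hfat.trans (liminf_le_of_frequently_le' (Frequently.of_forall fun n => ?_))
    rw [← ofReal_integral_norm_eq_lintegral_enorm (hi n)]
    exact ENNReal.ofReal_le_ofReal (hbound n)
  refine ⟨hint, ?_⟩
  choose y hy using fun n => h.indicator hx (hA n).compl
  -- The truncations converge to x in norm by order continuity; below, their integrals converge by
  -- domination.
  have hlim1 : Tendsto (fun n => F (y n)) atTop (𝓝 (F x)) := by
    refine (F.continuous.tendsto x).comp ?_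
    rw [tendsto_iff_norm_sub_tendsto_zero]
    have := hoc x f hx A hA hAa hAe (fun n => x - y n) (fun n => ?_)
    · simpa only [norm_sub_rev] using this
    · refine h.congr (h.sub hx (hy n)) (Eventually.of_forall fun ω => ?_)
      by_cases hω : ω ∈ A n <;> simp [hω]
  have hlim2 : Tendsto (fun n => F (y n)) atTop (𝓝 (∫ ω, f ω * k ω ∂μ)) := by
    have : ∀ n, F (y n) = ∫ ω, (A n)ᶜ.indicator f ω * k ω ∂μ := fun n =>
      h.apply_bounded_eq_integral F hk hind (hy n) (hf.indicator (hA n).compl) (hbd n)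
    simp only [this]
    refine tendsto_integral_of_dominated_convergence (fun ω => |f ω * k ω|)
      (fun n => ((hf.indicator (hA n).compl).mul hkm).aestronglyMeasurable) hint.abs
      (fun n => Eventually.of_forall fun ω => ?_) (Eventually.of_forall fun ω => ?_)
    · rw [Real.norm_eq_abs, abs_mul, abs_mul]
      exact mul_le_mul_of_nonneg_right (hle n ω) (abs_nonneg _)
    · exact tendsto_const_nhds.congr' ((hev ω).mono fun n hn => by simp only [hn])
  exact tendsto_nhds_unique hlim1 hlim2

end IsSolidRepresentation

/-! ### Function spaces inside L¹ and monotone convergence in norm -/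

/-- The relation `R` represents every vector of `E` by an integrable function, unique up to null
sets, and makes `E` a solid space of functions. -/
structure IsFunctionSpace {Ω E : Type*} [MeasurableSpace Ω] (μ : Measure Ω)
    [NormedAddCommGroup E] [NormedSpace ℝ E] (R : E → (Ω → ℝ) → Prop) : Prop
    extends IsSolidRepresentation μ R where
  total : ∀ x, ∃ f, R x f
  integrable : ∀ {x f}, R x f → Integrable f μ
  ae_eq : ∀ {x f g}, R x f → R x g → f =ᵐ[μ] g

/-- There is a positive sequence, bounded away from `0`, with bounded partial sums. -/
def HasBoundedPositiveSeries {Ω E : Type*} [MeasurableSpace Ω] (μ : Measure Ω)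
    [NormedAddCommGroup E] (R : E → (Ω → ℝ) → Prop) : Prop :=
  ∃ (u : ℕ → E) (f : ℕ → Ω → ℝ) (δ C : ℝ), 0 < δ ∧ (∀ k, R (u k) (f k)) ∧
    (∀ k, ∀ᵐ ω ∂μ, 0 ≤ f k ω) ∧ (∀ k, δ ≤ ‖u k‖) ∧ ∀ n, ‖∑ k ∈ Finset.range n, u k‖ ≤ C

namespace IsFunctionSpace

variable {Ω E : Type*} [MeasurableSpace Ω] {μ : Measure Ω} [NormedAddCommGroup E] [NormedSpace ℝ E]
  {R : E → (Ω → ℝ) → Prop}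

/-- The positive cone is closed: the negative part of g is at most |g - f n| as soon as f n ≥ 0, so
its norm is at most ‖x - v n‖, which tends to 0. -/
theorem nonneg_of_tendsto (h : IsFunctionSpace μ R) {v : ℕ → E} {f : ℕ → Ω → ℝ} {x : E}
    {g : Ω → ℝ} (hv : ∀ᶠ n in atTop, R (v n) (f n) ∧ ∀ᵐ ω ∂μ, 0 ≤ f n ω) (hx : R x g)
    (hlim : Tendsto v atTop (𝓝 x)) : ∀ᵐ ω ∂μ, 0 ≤ g ω := by
  have hg := h.aestronglyMeasurable hx
  obtain ⟨y, hy, -⟩ := h.solid (g := fun ω => max (-g ω) 0) hx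
    (hg.neg.sup aestronglyMeasurable_const) (Eventually.of_forall fun ω => by
      rw [abs_of_nonneg (le_max_right _ _)]
      exact max_le (neg_le_abs _) (abs_nonneg _))
  have hy0 : ‖y‖ ≤ 0 := by
    have : Tendsto (fun n => ‖x - v n‖) atTop (𝓝 0) := by
      simpa only [norm_sub_rev] using tendsto_iff_norm_sub_tendsto_zero.1 hlim
    refine ge_of_tendsto this ?_
    filter_upwards [hv] with n hn
    refine h.norm_mono hy (h.sub hx hn.1) ?_
    filter_upwards [hn.2] with ω hω
    rw [abs_of_nonneg (le_max_right _ _)]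
    refine max_le ?_ (abs_nonneg _)
    linarith [neg_le_abs (g ω - f n ω)]
  rw [norm_le_zero_iff] at hy0
  subst hy0
  filter_upwards [h.ae_eq hy h.zero] with ω hω
  have := le_max_left (-g ω) 0
  linarith

theorem le_of_tendsto_of_monotone (h : IsFunctionSpace μ R) {v : ℕ → E} {f : ℕ → Ω → ℝ}
    (hv : ∀ n, R (v n) (f n)) (hmono : ∀ m n, m ≤ n → ∀ᵐ ω ∂μ, f m ω ≤ f n ω) {x : E} {g : Ω → ℝ}
    (hx : R x g) (hlim : Tendsto v atTop (𝓝 x)) (m : ℕ) : ∀ᵐ ω ∂μ, f m ω ≤ g ω := by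
  have := h.nonneg_of_tendsto (v := fun n => v n - v m) (f := fun n ω => f n ω - f m ω) ?_
    (h.sub hx (hv m)) (hlim.sub_const _)
  · filter_upwards [this] with ω hω using sub_nonneg.1 hω
  · filter_upwards [eventually_ge_atTop m] with n hn
    exact ⟨h.sub (hv n) (hv m), by filter_upwards [hmono m n hn] with ω hω using sub_nonneg.2 hω⟩

/-- The inclusion of a complete function space in `L¹` is bounded. -/
theorem exists_integral_abs_le [CompleteSpace E] (h : IsFunctionSpace μ R) :
    ∃ K : ℝ, 0 ≤ K ∧ ∀ x f, R x f → ∫ ω, |f ω| ∂μ ≤ K * ‖x‖ := by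
  by_contra! hcon
  -- If no constant works, there are positive vectors of norm at most 2⁻ⁿ with integral at least n.
  -- Their sum exists by completeness and dominates each of them, so its integral would exceed every
  -- n.
  have hstep : ∀ n : ℕ, ∃ (y : E) (q : Ω → ℝ), R y q ∧ (∀ ω, 0 ≤ q ω) ∧ ‖y‖ ≤ (1 / 2) ^ n ∧
      (n : ℝ) ≤ ∫ ω, q ω ∂μ := by
    intro n
    obtain ⟨x, f, hx, hxf⟩ := hcon (n * 2 ^ n) (by positivity)
    obtain ⟨y, hy, hyn⟩ := h.solid (g := fun ω => |f ω|) hx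
      (h.aestronglyMeasurable hx).norm (Eventually.of_forall fun ω => by simp)
    by_cases hx0 : ‖x‖ = 0
    · rw [norm_eq_zero] at hx0
      subst hx0
      have : ∫ ω, |f ω| ∂μ = 0 := by
        rw [integral_congr_ae (g := fun _ => 0)]
        · simp
        · filter_upwards [h.ae_eq hx h.zero] with ω hω
          simp [hω]
      simp [this] at hxf
    · have hpos : 0 < ‖x‖ := lt_of_le_of_ne (norm_nonneg _) (Ne.symm hx0)
      refine ⟨((1 / 2) ^ n / ‖x‖) • y, _, h.smul _ hy, fun ω => by positivity, ?_, ?_⟩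
      · rw [norm_smul, Real.norm_of_nonneg (by positivity)]
        calc (1 / 2 : ℝ) ^ n / ‖x‖ * ‖y‖ ≤ (1 / 2 : ℝ) ^ n / ‖x‖ * ‖x‖ := by gcongr
          _ = _ := by field_simp
      · rw [integral_const_mul]
        calc (n : ℝ) = (1 / 2) ^ n / ‖x‖ * (n * 2 ^ n * ‖x‖) := by
              field_simp
              rw [mul_assoc, ← mul_pow]
              norm_num
          _ ≤ _ := by gcongr
  choose y q hy hq hyn hqn using hstep
  have hsum : Summable y := Summable.of_norm_bounded summable_geometric_two hyn
  obtain ⟨g, hg⟩ := h.total (∑' n, y n)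
  have hle : ∀ n, ∀ᵐ ω ∂μ, q n ω ≤ g ω := by
    intro n
    have := h.nonneg_of_tendsto (v := fun m => ∑ i ∈ Finset.range m, y i - y n)
      (f := fun m ω => ∑ i ∈ Finset.range m, q i ω - q n ω) ?_ (h.sub hg (hy n))
      (hsum.hasSum.tendsto_sum_nat.sub_const _)
    · filter_upwards [this] with ω hω using sub_nonneg.1 hω
    · filter_upwards [eventually_gt_atTop n] with m hm
      refine ⟨h.sub (h.sum _ fun i _ => hy i) (hy n), Eventually.of_forall fun ω => ?_⟩
      exact sub_nonneg.2 (Finset.single_le_sum (f := fun i => q i ω) (fun i _ => hq i ω)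
        (Finset.mem_range.2 hm))
  obtain ⟨n, hn⟩ := exists_nat_gt (∫ ω, g ω ∂μ)
  exact absurd ((hqn n).trans (integral_mono_ae (h.integrable (hy n)) (h.integrable hg) (hle n)))
    (not_le.2 hn)

/-- If there is no positive sequence bounded away from zero with bounded partial sums, then
increasing norm bounded sequences converge. -/
theorem cauchySeq_of_monotone (h : IsFunctionSpace μ R) (hno : ¬ HasBoundedPositiveSeries μ R)
    {v : ℕ → E} {f : ℕ → Ω → ℝ} (hv : ∀ n, R (v n) (f n))
    (hmono : ∀ m n, m ≤ n → ∀ᵐ ω ∂μ, f m ω ≤ f n ω) {C : ℝ} (hC : ∀ n, ‖v n‖ ≤ C) :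
    CauchySeq v := by
  rw [Metric.cauchySeq_iff']
  by_contra! hcon
  obtain ⟨ε, hε, hcon⟩ := hcon
  choose s hs hsε using hcon
  -- Along the iterates of s, successive differences are positive with norm at least ε, and their
  -- sums telescope to norm at most 2C: the excluded series.
  let t : ℕ → ℕ := fun n => s^[n] 0
  have ht : ∀ n, t (n + 1) = s (t n) := fun n => Function.iterate_succ_apply' s n 0
  refine hno ⟨fun k => v (t (k + 1)) - v (t k), fun k ω => f (t (k + 1)) ω - f (t k) ω, ε, C + C,
    hε, fun k => h.sub (hv _) (hv _), fun k => ?_, fun k => ?_, fun n => ?_⟩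
  · have : t k ≤ t (k + 1) := by rw [ht]; exact hs _
    filter_upwards [hmono _ _ this] with ω hω using sub_nonneg.2 hω
  · change ε ≤ ‖v (t (k + 1)) - v (t k)‖
    rw [ht, ← dist_eq_norm]
    exact hsε _
  · rw [Finset.sum_range_sub fun k => v (t k)]
    exact (norm_sub_le _ _).trans (add_le_add (hC _) (hC _))

/-- The functions |f| cut off to the complements of A n increase and are norm bounded, so they
converge. The limit lies above each of them and below |f|, so it is |f|, and the parts on A n tend
to 0. -/
theorem orderContinuous [CompleteSpace E] (h : IsFunctionSpace μ R)
    (hno : ¬ HasBoundedPositiveSeries μ R) :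
    IsSolidRepresentation.OrderContinuous R := by
  intro x f hx A hA hAa hAe y hy
  obtain ⟨w, hw, -⟩ := h.solid (g := fun ω => |f ω|) hx (h.aestronglyMeasurable hx).norm
    (Eventually.of_forall fun ω => by simp)
  choose v hv using fun n => h.indicator hw (hA n).compl
  have hind : ∀ n ω, 0 ≤ (A n)ᶜ.indicator (fun ω => |f ω|) ω ∧
      (A n)ᶜ.indicator (fun ω => |f ω|) ω ≤ |f ω| := fun n ω => by
    by_cases hω : ω ∈ A n <;> simp [hω]
  have hmono : ∀ m n, m ≤ n → ∀ᵐ ω ∂μ,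
      (A m)ᶜ.indicator (fun ω => |f ω|) ω ≤ (A n)ᶜ.indicator (fun ω => |f ω|) ω := by
    intro m n hmn
    refine Eventually.of_forall fun ω => ?_
    by_cases hω : ω ∈ A m
    · rw [Set.indicator_of_notMem (show ω ∉ (A m)ᶜ from fun hc => hc hω)]
      exact (hind n ω).1
    · rw [Set.indicator_of_mem (show ω ∈ (A m)ᶜ from hω),
        Set.indicator_of_mem (show ω ∈ (A n)ᶜ from fun hc => hω (hAa hmn hc))]
  have hcs := h.cauchySeq_of_monotone hno hv hmono (C := ‖w‖) fun n =>
    h.norm_mono (hv n) hw (Eventually.of_forall fun ω => by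
      rw [abs_of_nonneg (hind n ω).1, abs_abs]; exact (hind n ω).2)
  obtain ⟨z, hz⟩ := cauchySeq_tendsto_of_complete hcs
  obtain ⟨g, hg⟩ := h.total z
  have h1 : ∀ᵐ ω ∂μ, ∀ n, (A n)ᶜ.indicator (fun ω => |f ω|) ω ≤ g ω :=
    ae_all_iff.2 fun n => h.le_of_tendsto_of_monotone hv hmono hg hz n
  have h2 : ∀ᵐ ω ∂μ, 0 ≤ |f ω| - g ω :=
    h.nonneg_of_tendsto (Eventually.of_forall fun n => ⟨h.sub hw (hv n),
      Eventually.of_forall fun ω => sub_nonneg.2 (hind n ω).2⟩) (h.sub hw hg)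
      (tendsto_const_nhds.sub hz)
  have hgf : g =ᵐ[μ] fun ω => |f ω| := by
    filter_upwards [h1, h2] with ω hω1 hω2
    refine le_antisymm (sub_nonneg.1 hω2) ?_
    have : ω ∉ ⋂ n, A n := by rw [hAe]; simp
    simp only [Set.mem_iInter, not_forall] at this
    obtain ⟨n, hn⟩ := this
    have := hω1 n
    rwa [Set.indicator_of_mem (show ω ∈ (A n)ᶜ from hn)] at this
  have hzw : z = w := h.unique (h.congr hg hgf) hw
  rw [hzw, tendsto_iff_norm_sub_tendsto_zero] at hz
  refine squeeze_zero (fun n => norm_nonneg _) (fun n => ?_) hz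
  refine h.norm_mono (hy n) (h.sub (hv n) hw) (Eventually.of_forall fun ω => ?_)
  by_cases hω : ω ∈ A n <;> simp [hω]

end IsFunctionSpace

/-! ### Norm estimates in order continuous spaces -/

namespace IsSolidRepresentation

variable {Ω X : Type*} [MeasurableSpace Ω] {μ : Measure Ω} [NormedAddCommGroup X] [NormedSpace ℝ X]
  {R : X → (Ω → ℝ) → Prop}

/-- Borel-Cantelli: sets with measure below 2⁻ⁿ have a null limsup. Their tail unions with the
limsup removed decrease to ∅, and modulo null sets they contain the given sets, whose indicators
would keep norm at least ε. -/
theorem exists_norm_indicator_lt (h : IsSolidRepresentation μ R) (hoc : OrderContinuous R)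
    {ε : ℝ} (hε : 0 < ε) : ∃ δ : ENNReal, 0 < δ ∧ ∀ A, MeasurableSet A → μ A < δ → ∀ x,
      R x (A.indicator fun _ => 1) → ‖x‖ < ε := by
  by_contra! hcon
  obtain ⟨e, he⟩ := h.one
  have hpos : ∀ n : ℕ, (0 : ENNReal) < 2⁻¹ ^ n := fun n =>
    ENNReal.pow_pos (ENNReal.inv_pos.2 (by simp)) n
  choose A hA hAμ x hx hxε using fun n : ℕ => hcon (2⁻¹ ^ n) (hpos n)
  have hlimsup : μ (limsup A atTop) = 0 := by
    refine measure_limsup_atTop_eq_zero (ne_top_of_le_ne_top ?_ (ENNReal.tsum_le_tsum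
      fun n => (hAμ n).le))
    rw [ENNReal.tsum_geometric]
    simp
  let B : ℕ → Set Ω := fun n => (⋃ i ≥ n, A i) \ limsup A atTop
  have hBm : ∀ n, MeasurableSet (B n) := fun n =>
    (MeasurableSet.biUnion (Set.to_countable _) fun i _ => hA i).diff
      (MeasurableSet.measurableSet_limsup hA)
  have hBa : Antitone B := fun m n hmn => Set.sdiff_subset_sdiff_left
    (Set.biUnion_subset_biUnion_left fun i (hi : n ≤ i) => hmn.trans hi)
  have hBe : ⋂ n, B n = ∅ := by
    refine Set.eq_empty_of_forall_notMem fun ω hω => ?_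
    rw [Set.mem_iInter] at hω
    refine (hω 0).2 ?_
    rw [limsup_eq_iInf_iSup_of_nat]
    simp only [Set.iInf_eq_iInter, Set.iSup_eq_iUnion, Set.mem_iInter]
    exact fun n => (hω n).1
  choose y hy using fun n => h.indicator he (hBm n)
  have hlim := hoc e _ he B hBm hBa hBe y hy
  obtain ⟨n, hn⟩ := (hlim.eventually (gt_mem_nhds hε)).exists
  refine absurd (lt_of_le_of_lt ?_ hn) (not_lt.2 (hxε n))
  refine h.norm_mono (hx n) (hy n) ?_
  filter_upwards [measure_eq_zero_iff_ae_notMem.1 hlimsup] with ω hω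
  by_cases hωA : ω ∈ A n
  · have : ω ∈ B n := ⟨Set.mem_biUnion (show n ∈ {i | i ≥ n} from le_refl n) hωA, hω⟩
    simp [hωA, this]
  · simp [hωA]

/-- In an order continuous space, uniformly bounded functions that are small in `L²` are small in
norm. -/
theorem exists_norm_le_of_integral_sq_le [IsFiniteMeasure μ] (h : IsSolidRepresentation μ R)
    (hoc : OrderContinuous R) (C : ℝ) (hC : 0 ≤ C) {ε : ℝ} (hε : 0 < ε) :
    ∃ θ : ℝ, 0 < θ ∧ ∀ x f, R x f → (∀ᵐ ω ∂μ, |f ω| ≤ C) → ∫ ω, f ω ^ 2 ∂μ ≤ θ → ‖x‖ ≤ ε := by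
  obtain ⟨e, he⟩ := h.one
  -- The estimate is |f| ≤ η + C·1_{|f| > η}. The constant part costs ε/2 by the choice of η; the
  -- set is small by Chebyshev, which dictates θ = δ'η². The denominators ‖e‖ + 1 and C + 1 avoid
  -- division by zero.
  obtain ⟨η, hη, hηe⟩ : ∃ η : ℝ, 0 < η ∧ η * ‖e‖ ≤ ε / 2 := by
    refine ⟨ε / 2 / (‖e‖ + 1), by positivity, ?_⟩
    rw [div_mul_eq_mul_div, div_le_iff₀ (by positivity)]
    nlinarith [norm_nonneg e]
  obtain ⟨δ, hδ, hsmall⟩ := h.exists_norm_indicator_lt hoc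
    (show 0 < ε / 2 / (C + 1) by positivity)
  obtain ⟨δ', hδ', hδδ⟩ : ∃ δ' : ℝ, 0 < δ' ∧ ENNReal.ofReal δ' < δ := by
    obtain ⟨r, hr0, hr⟩ := ENNReal.lt_iff_exists_nnreal_btwn.1 hδ
    exact ⟨r, by exact_mod_cast hr0, by simpa using hr⟩
  refine ⟨δ' * η ^ 2, by positivity, fun x f₀ hx₀ hf₀ hint₀ => ?_⟩
  obtain ⟨f, hfs, hff⟩ := h.aestronglyMeasurable hx₀
  have hf : Measurable f := hfs.measurable
  have hx : R x f := h.congr hx₀ hff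
  have hfC : ∀ᵐ ω ∂μ, |f ω| ≤ C := by
    filter_upwards [hf₀, hff] with ω h1 h2
    rwa [← h2]
  have hint : ∫ ω, f ω ^ 2 ∂μ ≤ δ' * η ^ 2 := by
    rwa [integral_congr_ae (g := fun ω => f₀ ω ^ 2)]
    filter_upwards [hff] with ω h2
    rw [h2]
  have hA : MeasurableSet {ω | η < |f ω|} := measurableSet_lt measurable_const hf.abs
  set A := {ω | η < |f ω|} with hAdef
  have hfi : Integrable (fun ω => f ω ^ 2) μ := by
    refine Integrable.of_bound (hf.pow_const 2).aestronglyMeasurable (C ^ 2) ?_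
    filter_upwards [hfC] with ω hω
    rw [Real.norm_eq_abs, abs_pow]
    gcongr
  have hμA : μ A < δ := by
    refine lt_of_le_of_lt ?_ hδδ
    have h1 := mul_meas_ge_le_integral_of_nonneg (Eventually.of_forall fun ω => sq_nonneg (f ω))
      hfi (η ^ 2)
    have h2 : μ.real A ≤ μ.real {ω | η ^ 2 ≤ f ω ^ 2} := by
      refine measureReal_mono fun ω (hω : η < |f ω|) => ?_
      have : η ^ 2 ≤ |f ω| ^ 2 := by gcongr
      rwa [sq_abs] at this
    have h3 : η ^ 2 * μ.real A ≤ η ^ 2 * δ' := by nlinarith [sq_nonneg η]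
    have h4 := le_of_mul_le_mul_left h3 (by positivity)
    rw [← ofReal_measureReal]
    exact ENNReal.ofReal_le_ofReal h4
  obtain ⟨y, hy⟩ := h.indicator he hA
  have hyn := hsmall A hA hμA y hy
  have hle : ‖x‖ ≤ ‖η • e + C • y‖ := by
    refine h.norm_mono hx (h.add (h.smul η he) (h.smul C hy)) ?_
    filter_upwards [hfC] with ω hω
    refine le_trans ?_ (le_abs_self _)
    by_cases hωA : ω ∈ A
    · rw [Set.indicator_of_mem hωA]
      linarith
    · rw [Set.indicator_of_notMem hωA]
      have : |f ω| ≤ η := not_lt.1 hωA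
      linarith
  calc ‖x‖ ≤ ‖η • e‖ + ‖C • y‖ := hle.trans (norm_add_le _ _)
    _ = η * ‖e‖ + C * ‖y‖ := by
      rw [norm_smul, norm_smul, Real.norm_of_nonneg hη.le, Real.norm_of_nonneg hC]
    _ ≤ ε / 2 + C * (ε / 2 / (C + 1)) := by gcongr
    _ ≤ ε / 2 + ε / 2 := by
      gcongr
      rw [mul_div_assoc', div_le_iff₀ (by positivity)]
      nlinarith
    _ = ε := by ring

end IsSolidRepresentation

/-! ### Gliding hump and compactness -/

/-- Finitely many functionals cannot separate the points of an infinite-dimensional subspace;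
normalise a kernel vector. -/
theorem Submodule.exists_norm_eq_one_of_not_finiteDimensional {E : Type*} [NormedAddCommGroup E]
    [NormedSpace ℝ E] {M : Submodule ℝ E} (hM : ¬ FiniteDimensional ℝ M) (a : ℕ → E →L[ℝ] ℝ)
    (N : ℕ) : ∃ x ∈ M, ‖x‖ = 1 ∧ ∀ i < N, a i x = 0 := by
  let A : M →ₗ[ℝ] (Fin N → ℝ) := LinearMap.pi fun i => (a i).toLinearMap.comp M.subtype
  have hA : ¬ Function.Injective A := fun hc => hM (Module.Finite.of_injective A hc)
  rw [← LinearMap.ker_eq_bot, Submodule.eq_bot_iff] at hA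
  push Not at hA
  obtain ⟨x, hx, hx0⟩ := hA
  have hx0' : (x : E) ≠ 0 := by simpa using hx0
  refine ⟨‖(x : E)‖⁻¹ • (x : E), M.smul_mem _ x.2, ?_, fun i hi => ?_⟩
  · rw [norm_smul, norm_inv, norm_norm, inv_mul_cancel₀ (norm_ne_zero_iff.2 hx0')]
  · have : a i x = 0 := congrFun (LinearMap.mem_ker.1 hx) ⟨i, hi⟩
    rw [map_smul, this, smul_zero]

/-- The gliding hump: in an infinite dimensional subspace there are unit vectors that are almost
disjointly supported with respect to a sequence of coordinates. The predicate `Q x ε N` says that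
the coordinates of `x` from `N` on are smaller than `ε`. -/
theorem Submodule.exists_gliding_hump {E : Type*} [NormedAddCommGroup E]
    [NormedSpace ℝ E] {M : Submodule ℝ E} (hM : ¬ FiniteDimensional ℝ M) (a : ℕ → E →L[ℝ] ℝ)
    (Q : E → ℝ → ℕ → Prop) (hQ : ∀ x ε, 0 < ε → ∀ᶠ N in atTop, Q x ε N)
    (hQ' : ∀ x ε ε' N, ε ≤ ε' → Q x ε N → Q x ε' N) :
    ∃ (x : ℕ → E) (N : ℕ → ℕ), (∀ k, x k ∈ M) ∧ (∀ k, ‖x k‖ = 1) ∧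
      (∀ k, ∀ i < N k, a i (x k) = 0) ∧ ∀ k j, k < j → Q (x k) ((1 / 2) ^ k) (N j) := by
  -- Triples (vector, cut-off, counter). The cut-off lies beyond the essential coordinates of all
  -- earlier vectors. The counter increases strictly, so the k-th one is at least k, which converts
  -- the tolerance into 2⁻ᵏ.
  obtain ⟨f, hf, hr⟩ := exists_seq_of_forall_finset_exists
    (fun p : E × ℕ × ℕ => p.1 ∈ M ∧ ‖p.1‖ = 1 ∧ ∀ i < p.2.1, a i p.1 = 0)
    (fun p q => p.2.2 < q.2.2 ∧ Q p.1 ((1 / 2) ^ p.2.2) q.2.1) (by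
      intro s _
      have hev : ∀ᶠ N in atTop, ∀ p ∈ s, Q p.1 ((1 / 2) ^ p.2.2) N :=
        (Filter.eventually_all_finset s).2 fun p _ => hQ _ _ (by positivity)
      obtain ⟨N, hN⟩ := hev.exists
      obtain ⟨x, hxM, hx1, hx⟩ := Submodule.exists_norm_eq_one_of_not_finiteDimensional hM a N
      refine ⟨(x, N, s.sup (fun p => p.2.2) + 1), ⟨hxM, hx1, hx⟩, fun p hp => ⟨?_, hN p hp⟩⟩
      exact Nat.lt_succ_of_le (Finset.le_sup (f := fun p : E × ℕ × ℕ => p.2.2) hp))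
  have hmono : StrictMono fun k => (f k).2.2 := fun m n hmn => (hr m n hmn).1
  refine ⟨fun k => (f k).1, fun k => (f k).2.1, fun k => (hf k).1, fun k => (hf k).2.1,
    fun k => (hf k).2.2, fun k j hkj => hQ' _ _ _ _ ?_ (hr k j hkj).2⟩
  exact pow_le_pow_of_le_one (by norm_num) (by norm_num) (hmono.id_le k)

theorem IsCompactOperator.exists_tendsto_subseq {E : Type*} [NormedAddCommGroup E]
    [NormedSpace ℝ E] {T : E →L[ℝ] E} (hT : IsCompactOperator T) {z : ℕ → E} {C : ℝ}
    (hz : ∀ n, ‖z n‖ ≤ C) :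
    ∃ (y : E) (φ : ℕ → ℕ), StrictMono φ ∧ Tendsto (fun n => T (z (φ n))) atTop (𝓝 y) := by
  obtain ⟨K, hK, hsub⟩ := hT.image_closedBall_subset_compact (f := (T : E →ₗ[ℝ] E)) C
  obtain ⟨y, -, φ, hφ, hlim⟩ := hK.tendsto_subseq (x := fun n => T (z n)) fun n =>
    hsub ⟨z n, by simpa using hz n, rfl⟩
  exact ⟨y, φ, hφ, hlim⟩

/-! ### Khintchine's inequality and the Orlicz property of L¹ -/

section Khintchine

variable {κ : Type*} [DecidableEq κ]

/-- The sum of `a` over `s` with sign `+` on `S` and `-` off `S`. -/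
def signedSum {V : Type*} [AddCommGroup V] (s S : Finset κ) (a : κ → V) : V :=
  ∑ k ∈ s, if k ∈ S then a k else -a k

theorem signedSum_insert_of_notMem {s S : Finset κ} {i : κ} (hi : i ∉ s) (hS : S ⊆ s)
    (a : κ → ℝ) : signedSum (insert i s) S a = signedSum s S a - a i := by
  rw [signedSum, Finset.sum_insert hi, if_neg fun hc => hi (hS hc), signedSum]
  ring

theorem signedSum_insert_insert {s : Finset κ} {i : κ} (hi : i ∉ s) (S : Finset κ)
    (a : κ → ℝ) : signedSum (insert i s) (insert i S) a = signedSum s S a + a i := by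
  rw [signedSum, Finset.sum_insert hi, if_pos (Finset.mem_insert_self _ _), signedSum, add_comm]
  congr 1
  refine Finset.sum_congr rfl fun k hk => ?_
  have : k ≠ i := fun hc => hi (hc ▸ hk)
  simp [Finset.mem_insert, this]

theorem sum_signedSum_sq (s : Finset κ) (a : κ → ℝ) :
    ∑ S ∈ s.powerset, signedSum s S a ^ 2 = 2 ^ s.card * ∑ k ∈ s, a k ^ 2 := by
  induction s using Finset.induction_on with
  | empty => simp [signedSum]
  | insert i s hi ih =>
    rw [Finset.sum_powerset_insert hi, Finset.card_insert_of_notMem hi, Finset.sum_insert hi,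
      ← Finset.sum_add_distrib]
    have : ∀ S ∈ s.powerset, signedSum (insert i s) S a ^ 2
        + signedSum (insert i s) (insert i S) a ^ 2 = 2 * signedSum s S a ^ 2 + 2 * a i ^ 2 := by
      intro S hS
      rw [signedSum_insert_of_notMem hi (Finset.mem_powerset.1 hS), signedSum_insert_insert hi]
      ring
    rw [Finset.sum_congr rfl this, Finset.sum_add_distrib, ← Finset.mul_sum, ih, Finset.sum_const,
      Finset.card_powerset, nsmul_eq_mul]
    push_cast
    ring

/-- Induction with (X - a)⁴ + (X + a)⁴ = 2X⁴ + 12a²X² + 2a⁴. The constant 3 makes the mixed terms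
match exactly, with only a surplus of a⁴ left over. -/
theorem sum_signedSum_pow_four_le (s : Finset κ) (a : κ → ℝ) :
    ∑ S ∈ s.powerset, signedSum s S a ^ 4 ≤ 3 * 2 ^ s.card * (∑ k ∈ s, a k ^ 2) ^ 2 := by
  induction s using Finset.induction_on with
  | empty => simp [signedSum]
  | insert i s hi ih =>
    rw [Finset.sum_powerset_insert hi, Finset.card_insert_of_notMem hi, Finset.sum_insert hi,
      ← Finset.sum_add_distrib]
    have : ∀ S ∈ s.powerset, signedSum (insert i s) S a ^ 4
        + signedSum (insert i s) (insert i S) a ^ 4 =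
        2 * signedSum s S a ^ 4 + 12 * a i ^ 2 * signedSum s S a ^ 2 + 2 * a i ^ 4 := by
      intro S hS
      rw [signedSum_insert_of_notMem hi (Finset.mem_powerset.1 hS), signedSum_insert_insert hi]
      ring
    rw [Finset.sum_congr rfl this, Finset.sum_add_distrib, Finset.sum_add_distrib,
      ← Finset.mul_sum, ← Finset.mul_sum, sum_signedSum_sq, Finset.sum_const,
      Finset.card_powerset, nsmul_eq_mul]
    push_cast
    have h4 : 0 ≤ (2 : ℝ) ^ s.card * a i ^ 4 := by positivity
    rw [pow_succ (2 : ℝ)]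
    nlinarith

/-- Coordinates of signed sums of almost disjointly supported vectors stay bounded. -/
theorem abs_apply_signedSum_le {E : Type*} [NormedAddCommGroup E] [NormedSpace ℝ E]
    (a : ℕ → E →L[ℝ] ℝ) {x : ℕ → E} {N : ℕ → ℕ} {D : ℝ} (hD : ∀ i k, |a i (x k)| ≤ D)
    (hN : ∀ k, ∀ i < N k, a i (x k) = 0)
    (hQ : ∀ k j, k < j → ∀ i ≥ N j, |a i (x k)| ≤ (1 / 2) ^ k) (n : ℕ) (S : Finset ℕ) (i : ℕ) :
    |a i (signedSum (Finset.range n) S x)| ≤ D + 2 := by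
  have key : |a i (signedSum (Finset.range n) S x)| ≤
      D + ∑ k ∈ Finset.range n, (1 / 2 : ℝ) ^ k := by
    -- If i < N n the new vector has no i-th coordinate. Otherwise all earlier ones are in their
    -- tails and contribute a geometric sum, and only the new vector costs D.
    induction n with
    | zero =>
      simp only [signedSum, Finset.range_zero, Finset.sum_empty, map_zero, abs_zero, add_zero]
      exact (abs_nonneg _).trans (hD 0 0)
    | succ n ih =>
      have hle : ∀ k, |a i (if k ∈ S then x k else -x k)| = |a i (x k)| := fun k => by
        split_ifs <;> simp
      by_cases hi : i < N n
      · rw [signedSum, Finset.sum_range_succ, map_add]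
        have : a i (if n ∈ S then x n else -x n) = 0 := by
          rw [← abs_eq_zero, hle, hN n i hi, abs_zero]
        rw [this, add_zero, Finset.sum_range_succ, ← add_assoc]
        exact ih.trans (le_add_of_nonneg_right (by positivity))
      · rw [signedSum, map_sum, Finset.sum_range_succ, add_comm]
        refine (abs_add_le _ _).trans (add_le_add ?_ ?_)
        · rw [hle]
          exact hD i n
        · refine (Finset.abs_sum_le_sum_abs _ _).trans ?_
          rw [Finset.sum_range_succ]
          refine le_add_of_le_of_nonneg (Finset.sum_le_sum fun k hk => ?_) (by positivity)
          rw [hle]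
          exact hQ k n (Finset.mem_range.1 hk) i (not_lt.1 hi)
  have hgeom : ∑ k ∈ Finset.range n, (1 / 2 : ℝ) ^ k ≤ 2 :=
    (summable_geometric_two.sum_le_tsum _ fun k _ => by positivity).trans_eq tsum_geometric_two
  linarith

/-- A form of Khintchine's inequality. -/
theorem sum_abs_le_sum_abs_signedSum (s : Finset κ) (a : κ → ℝ) :
    4 / 9 * 2 ^ s.card * ∑ k ∈ s, |a k| ≤
      √(s.card) * ∑ S ∈ s.powerset, |signedSum s S a| := by
  set q := √(∑ k ∈ s, a k ^ 2) with hq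
  have hq2 : q ^ 2 = ∑ k ∈ s, a k ^ 2 := Real.sq_sqrt (Finset.sum_nonneg fun _ _ => sq_nonneg _)
  have hq0 : 0 ≤ q := Real.sqrt_nonneg _
  have hcs : ∑ k ∈ s, |a k| ≤ √(s.card) * q := by
    rw [hq, ← Real.sqrt_mul (Nat.cast_nonneg _)]
    refine Real.le_sqrt_of_sq_le ?_
    simpa using sq_sum_le_card_mul_sum_sq (s := s) (f := fun k => |a k|)
  -- A lower bound for |t| by moments, with equality at t = 0 and |t| = 3q. Averaging over signs,
  -- the second moment q² and the fourth moment bound 3q⁴ give q⁴(1/2 - 3/54) = (4/9)q⁴.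
  have hpt : ∀ t : ℝ, q ^ 2 * t ^ 2 / 2 - t ^ 4 / 54 ≤ q ^ 3 * |t| := by
    intro t
    have : 0 ≤ |t| * ((|t| - 3 * q) ^ 2 * (|t| + 6 * q)) := by positivity
    have h4 : t ^ 4 = |t| ^ 4 := by rw [← abs_pow, abs_of_nonneg (by positivity)]
    rw [← sq_abs t, h4]
    nlinarith
  have hkh : 4 / 9 * 2 ^ s.card * q ≤ ∑ S ∈ s.powerset, |signedSum s S a| := by
    rcases hq0.eq_or_lt with h0 | hpos
    · rw [← h0, mul_zero]
      exact Finset.sum_nonneg fun _ _ => abs_nonneg _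
    · have h1 := Finset.sum_le_sum fun S (_ : S ∈ s.powerset) => hpt (signedSum s S a)
      rw [Finset.sum_sub_distrib, ← Finset.sum_div, ← Finset.sum_div, ← Finset.mul_sum,
        ← Finset.mul_sum, sum_signedSum_sq] at h1
      have h2 := sum_signedSum_pow_four_le s a
      rw [← hq2] at h1 h2
      have h3 : q ^ 3 * (4 / 9 * 2 ^ s.card * q) ≤
          q ^ 3 * ∑ S ∈ s.powerset, |signedSum s S a| := by nlinarith
      exact le_of_mul_le_mul_left h3 (by positivity)
  calc 4 / 9 * 2 ^ s.card * ∑ k ∈ s, |a k| ≤ 4 / 9 * 2 ^ s.card * (√(s.card) * q) := by gcongr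
    _ = √(s.card) * (4 / 9 * 2 ^ s.card * q) := by ring
    _ ≤ _ := by gcongr

/-- The Orlicz property of `L¹`. -/
theorem sum_integral_abs_le_of_signedSum_le {Ω : Type*} [MeasurableSpace Ω] {μ : Measure Ω}
    (s : Finset κ) {f : κ → Ω → ℝ} (hf : ∀ k, Integrable (f k) μ) {C : ℝ}
    (hC : ∀ S, ∫ ω, |signedSum s S fun k => f k ω| ∂μ ≤ C) :
    4 / 9 * ∑ k ∈ s, ∫ ω, |f k ω| ∂μ ≤ √(s.card) * C := by
  have hi : ∀ S, Integrable (fun ω => signedSum s S fun k => f k ω) μ := fun S => by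
    unfold signedSum
    refine integrable_finsetSum s fun k _ => ?_
    split_ifs
    exacts [hf k, (hf k).neg]
  have h1 : ∫ ω, 4 / 9 * 2 ^ s.card * ∑ k ∈ s, |f k ω| ∂μ ≤
      ∫ ω, √(s.card) * ∑ S ∈ s.powerset, |signedSum s S fun k => f k ω| ∂μ :=
    integral_mono ((integrable_finsetSum s fun k _ => (hf k).abs).const_mul _)
      ((integrable_finsetSum _ fun S _ => (hi S).abs).const_mul _)
      fun ω => sum_abs_le_sum_abs_signedSum s fun k => f k ω
  rw [integral_const_mul, integral_const_mul, integral_finsetSum _ fun k _ => (hf k).abs,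
    integral_finsetSum _ fun S _ => (hi S).abs] at h1
  have h2 : ∑ S ∈ s.powerset, ∫ ω, |signedSum s S fun k => f k ω| ∂μ ≤ 2 ^ s.card * C := by
    refine (Finset.sum_le_sum fun S _ => hC S).trans ?_
    simp [Finset.card_powerset]
  have h3 : (2 : ℝ) ^ s.card * (4 / 9 * ∑ k ∈ s, ∫ ω, |f k ω| ∂μ) ≤
      2 ^ s.card * (√(s.card) * C) := by
    calc _ = 4 / 9 * 2 ^ s.card * ∑ k ∈ s, ∫ ω, |f k ω| ∂μ := by ring
      _ ≤ _ := h1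
      _ ≤ √(s.card) * (2 ^ s.card * C) := by gcongr
      _ = _ := by ring
  exact le_of_mul_le_mul_left h3 (by positivity)

end Khintchine

/-! ### The c₀ case -/

namespace IsFunctionSpace

variable {Ω E : Type*} [MeasurableSpace Ω] {μ : Measure Ω} [NormedAddCommGroup E] [NormedSpace ℝ E]
  {R : E → (Ω → ℝ) → Prop}

/-- Functions with a finite dual norm induce functionals. -/
theorem exists_functional_of_abs_integral_le (h : IsFunctionSpace μ R) {s : Ω → ℝ} {C : ℝ}
    (hC0 : 0 ≤ C) (hs : ∀ x f, R x f → Integrable (fun ω => f ω * s ω) μ)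
    (hC : ∀ x f, R x f → |∫ ω, f ω * s ω ∂μ| ≤ C * ‖x‖) :
    ∃ g : E →L[ℝ] ℝ, ‖g‖ ≤ C ∧ ∀ x f, R x f → g x = ∫ ω, f ω * s ω ∂μ := by
  choose φ hφ using h.total
  have hi : ∀ x, Integrable (fun ω => φ x ω * s ω) μ := fun x => hs _ _ (hφ x)
  have heq : ∀ x f, R x f → ∫ ω, φ x ω * s ω ∂μ = ∫ ω, f ω * s ω ∂μ := fun x f hx => by
    refine integral_congr_ae ?_
    filter_upwards [h.ae_eq (hφ x) hx] with ω hω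
    rw [hω]
  let g : E →ₗ[ℝ] ℝ :=
    { toFun := fun x => ∫ ω, φ x ω * s ω ∂μ
      map_add' := fun x y => by
        rw [heq _ _ (h.add (hφ x) (hφ y)), ← integral_add (hi x) (hi y)]
        simp only [add_mul]
      map_smul' := fun c x => by
        rw [heq _ _ (h.smul c (hφ x)), RingHom.id_apply, smul_eq_mul, ← integral_const_mul]
        simp only [mul_assoc] }
  exact ⟨g.mkContinuous C fun x => hC _ _ (hφ x), g.mkContinuous_norm_le hC0 _, heq⟩

/-- Bounded functions induce functionals on a complete function space. -/
theorem exists_functional [CompleteSpace E] (h : IsFunctionSpace μ R) {s : Ω → ℝ}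
    (hs : AEStronglyMeasurable s μ) {B : ℝ} (hB0 : 0 ≤ B) (hB : ∀ ω, |s ω| ≤ B) :
    ∃ g : E →L[ℝ] ℝ, ∀ x f, R x f → g x = ∫ ω, f ω * s ω ∂μ := by
  obtain ⟨K, hK0, hK⟩ := h.exists_integral_abs_le
  obtain ⟨g, -, hg⟩ := h.exists_functional_of_abs_integral_le (s := s) (C := B * K) (by positivity)
    (fun x f hx => (h.integrable hx).mul_bdd hs (Eventually.of_forall hB)) fun x f hx => by
      rw [mul_assoc, ← Real.norm_eq_abs]
      refine le_trans ?_ (mul_le_mul_of_nonneg_left (hK x f hx) hB0)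
      rw [← integral_const_mul]
      refine norm_integral_le_of_norm_le ((h.integrable hx).abs.const_mul B)
        (Eventually.of_forall fun ω => ?_)
      rw [Real.norm_eq_abs, abs_mul, mul_comm]
      exact mul_le_mul_of_nonneg_right (hB ω) (abs_nonneg _)
  exact ⟨g, hg⟩

/-- The upper c₀ estimate: by positivity the sum is dominated pointwise by D times a partial sum of
the f k. -/
theorem norm_sum_smul_le (h : IsFunctionSpace μ R) {u : ℕ → E} {f : ℕ → Ω → ℝ} {C : ℝ}
    (hu : ∀ k, R (u k) (f k)) (hf : ∀ k, ∀ᵐ ω ∂μ, 0 ≤ f k ω)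
    (hC : ∀ n, ‖∑ k ∈ Finset.range n, u k‖ ≤ C) (s : Finset ℕ) {c : ℕ → ℝ} {D : ℝ} (hD : 0 ≤ D)
    (hc : ∀ k ∈ s, |c k| ≤ D) : ‖∑ k ∈ s, c k • u k‖ ≤ D * C := by
  obtain ⟨n, hn⟩ := s.exists_nat_subset_range
  have h1 : ‖∑ k ∈ s, c k • u k‖ ≤ ‖D • ∑ k ∈ Finset.range n, u k‖ := by
    refine h.norm_mono (h.sum s fun k _ => h.smul (c k) (hu k))
      (h.smul D (h.sum (Finset.range n) fun k _ => hu k)) ?_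
    filter_upwards [ae_all_iff.2 hf] with ω hω
    refine le_trans ?_ (le_abs_self _)
    calc |∑ k ∈ s, c k * f k ω| ≤ ∑ k ∈ s, |c k * f k ω| := Finset.abs_sum_le_sum_abs _ _
      _ ≤ ∑ k ∈ s, D * f k ω := Finset.sum_le_sum fun k hk => by
        rw [abs_mul, abs_of_nonneg (hω k)]
        exact mul_le_mul_of_nonneg_right (hc k hk) (hω k)
      _ = D * ∑ k ∈ s, f k ω := (Finset.mul_sum _ _ _).symm
      _ ≤ _ := mul_le_mul_of_nonneg_left
        (Finset.sum_le_sum_of_subset_of_nonneg hn fun k _ _ => hω k) hD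
  rw [norm_smul, Real.norm_of_nonneg hD] at h1
  exact h1.trans (mul_le_mul_of_nonneg_left (hC n) hD)

/-- The operator with values in the span of a positive sequence with bounded partial sums whose
coefficients are given by a weak-star null sequence of functionals. -/
theorem exists_operator_of_positive_series [CompleteSpace E] (h : IsFunctionSpace μ R) {u : ℕ → E}
    {f : ℕ → Ω → ℝ} {C : ℝ} (hu : ∀ k, R (u k) (f k)) (hf : ∀ k, ∀ᵐ ω ∂μ, 0 ≤ f k ω)
    (hC : ∀ n, ‖∑ k ∈ Finset.range n, u k‖ ≤ C) (a : ℕ → E →L[ℝ] ℝ) {D : ℝ}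
    (haD : ∀ k x, |a k x| ≤ D * ‖x‖) (ha : ∀ x, Tendsto (fun k => a k x) atTop (𝓝 0)) :
    ∃ T : E →L[ℝ] E, (∀ x, HasSum (fun k => a k x • u k) (T x)) ∧
      ∀ x D', (∀ k, |a k x| ≤ D') → ‖T x‖ ≤ D' * C := by
  have hC0 : 0 ≤ C := by simpa using hC 0
  have hsum : ∀ x, Summable fun k => a k x • u k := by
    intro x
    rw [summable_iff_vanishing_norm]
    intro ε hε
    have hη : 0 < ε / (C + 1) := by positivity
    obtain ⟨n, hn⟩ := eventually_atTop.1 ((Metric.tendsto_nhds.1 (ha x)) _ hη)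
    refine ⟨Finset.range n, fun t ht => ?_⟩
    refine lt_of_le_of_lt (h.norm_sum_smul_le hu hf hC t hη.le fun k hk => ?_) ?_
    · have : n ≤ k := by
        by_contra hc
        exact Finset.disjoint_left.1 ht hk (Finset.mem_range.2 (not_le.1 hc))
      have := hn k this
      rw [Real.dist_eq, sub_zero] at this
      exact this.le
    · rw [div_mul_eq_mul_div, div_lt_iff₀ (by positivity)]
      nlinarith
  have hbound : ∀ x D', (∀ k, |a k x| ≤ D') → ‖∑' k, a k x • u k‖ ≤ D' * C := by
    intro x D' hD'
    exact le_of_tendsto (hsum x).hasSum.norm (Eventually.of_forall fun t =>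
      h.norm_sum_smul_le hu hf hC t ((abs_nonneg _).trans (hD' 0)) fun k _ => hD' k)
  let T : E →ₗ[ℝ] E :=
    { toFun := fun x => ∑' k, a k x • u k
      map_add' := fun x y => by
        rw [← (hsum x).tsum_add (hsum y)]
        simp only [map_add, add_smul]
      map_smul' := fun c x => by
        rw [RingHom.id_apply, ← (hsum x).tsum_const_smul c]
        simp only [map_smul, smul_assoc] }
  refine ⟨T.mkContinuous (D * C) fun x => ?_, fun x => (hsum x).hasSum, hbound⟩
  exact (hbound x _ fun k => haD k x).trans_eq (by ring)

/-- A function space with a positive sequence that is bounded away from zero and has bounded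
partial sums carries a strictly singular operator that is not compact. It factors through an
operator from `L¹` to `c₀`. -/
theorem exists_strictlySingular_of_positive_series [CompleteSpace E] (h : IsFunctionSpace μ R)
    (hpos : HasBoundedPositiveSeries μ R) {r : ℕ → Ω → ℝ} {B : ℝ}
    (hr : ∀ n, Measurable (r n)) (hB : 0 < B) (hrB : ∀ n ω, |r n ω| ≤ B)
    (hro : ∀ m n, ∫ ω, r m ω * r n ω ∂μ = if m = n then 1 else 0)
    (hr0 : ∀ f : Ω → ℝ, Integrable f μ → Tendsto (fun n => ∫ ω, f ω * r n ω ∂μ) atTop (𝓝 0)) :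
    ∃ T : E →L[ℝ] E, IsStrictlySingular T ∧ ¬ IsCompactOperator T := by
  obtain ⟨u, f, δ, C, hδ, hu, hf, huδ, hC⟩ := hpos
  have hC0 : 0 ≤ C := by simpa using hC 0
  obtain ⟨K, hK0, hK⟩ := h.exists_integral_abs_le
  obtain ⟨e, he⟩ := h.one
  choose φ hφ using h.total
  choose a ha using fun n => h.exists_functional (hr n).aestronglyMeasurable hB.le (hrB n)
  have haL : ∀ n x q, R x q → |a n x| ≤ B * ∫ ω, |q ω| ∂μ := fun n x q hx => by
    rw [ha n x q hx, ← Real.norm_eq_abs, ← integral_const_mul]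
    refine norm_integral_le_of_norm_le ((h.integrable hx).abs.const_mul B)
      (Eventually.of_forall fun ω => ?_)
    rw [Real.norm_eq_abs, abs_mul, mul_comm]
    exact mul_le_mul_of_nonneg_right (hrB n ω) (abs_nonneg _)
  have haK : ∀ n x, |a n x| ≤ B * K * ‖x‖ := fun n x => by
    refine (haL n x _ (hφ x)).trans ?_
    rw [mul_assoc]
    exact mul_le_mul_of_nonneg_left (hK _ _ (hφ x)) hB.le
  have ha0 : ∀ x, Tendsto (fun n => a n x) atTop (𝓝 0) := fun x => by
    simp only [fun n => ha n x _ (hφ x)]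
    exact hr0 _ (h.integrable (hφ x))
  obtain ⟨T, hT, hTb⟩ := h.exists_operator_of_positive_series hu hf hC a haK ha0
  refine ⟨T, ?_, ?_⟩
  · rintro M hM ⟨c, hc, hcM⟩
    obtain ⟨x, N, hxM, hx1, hxN, hxQ⟩ := Submodule.exists_gliding_hump hM a
      (fun x ε N => ∀ i ≥ N, |a i x| ≤ ε) (fun x ε hε => by
        obtain ⟨n, hn⟩ := eventually_atTop.1 ((Metric.tendsto_nhds.1 (ha0 x)) ε hε)
        filter_upwards [eventually_ge_atTop n] with m hm i hi
        have := hn i (hm.trans hi)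
        rw [Real.dist_eq, sub_zero] at this
        exact this.le) (fun x ε ε' N hεε hQ i hi => (hQ i hi).trans hεε)
    -- All signed sums of the humps have coordinates at most BK + 2. Since T depends only on these
    -- coordinates and is bounded below on M, the sums themselves are bounded in E, and so in L¹.
    have hsigned := abs_apply_signedSum_le a (D := B * K) (fun i k => by simpa [hx1] using haK i (x k))
      hxN hxQ
    have hnorm : ∀ n S, ‖signedSum (Finset.range n) S x‖ ≤ (B * K + 2) * C / c := by
      intro n S
      rw [le_div_iff₀ hc, mul_comm]
      refine (hcM _ ?_).trans (hTb _ _ fun i => hsigned n S i)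
      exact Submodule.sum_mem _ fun k _ => by
        split_ifs
        exacts [hxM k, M.neg_mem (hxM k)]
    -- T is already bounded for the L¹ norm, so its lower bound on M keeps the L¹ norms of the x k
    -- away from 0.
    have hone : ∀ k, c ≤ B * (∫ ω, |φ (x k) ω| ∂μ) * C := fun k => by
      have := (hcM _ (hxM k)).trans (hTb (x k) _ fun i => haL i _ _ (hφ _))
      rwa [hx1, mul_one] at this
    set Z := K * ((B * K + 2) * C / c) with hZ
    have hkh : ∀ n : ℕ, 4 / 9 * ∑ k ∈ Finset.range n, ∫ ω, |φ (x k) ω| ∂μ ≤ √n * Z := by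
      intro n
      have := sum_integral_abs_le_of_signedSum_le (μ := μ) (Finset.range n)
        (f := fun k => φ (x k)) (fun k => h.integrable (hφ _)) (C := Z) (fun S => ?_)
      · simpa using this
      · refine (hK (signedSum (Finset.range n) S x) _ ?_).trans
          (mul_le_mul_of_nonneg_left (hnorm n S) hK0)
        exact h.sum _ fun k _ => by
          split_ifs
          · exact hφ _
          · simpa using h.smul (-1) (hφ (x k))
    -- Linear growth against √n growth; taking n = m² removes the root.
    have hfin : ∀ m : ℕ, 0 < m → 4 / 9 * c * m ≤ Z * (B * C) := by
      intro m hm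
      have h1 := hkh (m ^ 2)
      have h2 : (m : ℝ) ^ 2 * c ≤
          (∑ k ∈ Finset.range (m ^ 2), ∫ ω, |φ (x k) ω| ∂μ) * (B * C) := by
        rw [Finset.sum_mul]
        have := Finset.sum_le_sum fun k (_ : k ∈ Finset.range (m ^ 2)) => hone k
        simp only [Finset.sum_const, Finset.card_range, nsmul_eq_mul] at this
        push_cast at this
        refine this.trans_eq (Finset.sum_congr rfl fun k _ => by ring)
      push_cast at h1
      rw [Real.sqrt_sq (Nat.cast_nonneg _)] at h1
      have h3 : (m : ℝ) * (4 / 9 * c * m) ≤ m * (Z * (B * C)) := by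
        have := mul_le_mul_of_nonneg_right h1 (show 0 ≤ B * C by positivity)
        nlinarith
      exact le_of_mul_le_mul_left h3 (by exact_mod_cast hm)
    obtain ⟨m, hm⟩ := exists_nat_gt (Z * (B * C) / (4 / 9 * c))
    rw [div_lt_iff₀ (by positivity)] at hm
    have := hfin (m + 1) (Nat.succ_pos _)
    push_cast at this
    nlinarith
  · intro hcomp
    choose w hw hwB using fun n => h.bounded he (hr n).aestronglyMeasurable hB.le
      (Eventually.of_forall (hrB n))
    have hTw : ∀ n, T (w n) = u n := fun n => by
      refine (hT (w n)).unique ?_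
      have hval : ∀ k, a k (w n) = if n = k then 1 else 0 := fun k => by
        rw [ha k _ _ (hw n), hro]
      have := hasSum_single (f := fun k => a k (w n) • u k) n fun k hk => by
        rw [hval, if_neg (Ne.symm hk), zero_smul]
      simpa [hval] using this
    obtain ⟨y, ψ, hψ, hlim⟩ := hcomp.exists_tendsto_subseq hwB
    simp only [hTw] at hlim
    -- A limit y of a subsequence of the u k must vanish: their integrals are summable, so their L¹
    -- norms tend to 0. This contradicts ‖u k‖ ≥ δ.
    have hsumm : Summable fun k => ∫ ω, f k ω ∂μ := by
      refine summable_of_sum_range_le (c := K * C) (fun k => integral_nonneg_of_ae (hf k))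
        fun n => ?_
      rw [← integral_finsetSum _ fun k _ => h.integrable (hu k)]
      have hs := h.sum (Finset.range n) fun k _ => hu k
      refine (integral_mono (h.integrable hs) (h.integrable hs).abs fun ω => le_abs_self _).trans ?_
      exact (hK _ _ hs).trans (mul_le_mul_of_nonneg_left (hC n) hK0)
    have hy0 : ∫ ω, |φ y ω| ∂μ ≤ 0 := by
      have h1 : Tendsto (fun n => K * ‖y - u (ψ n)‖ + ∫ ω, f (ψ n) ω ∂μ) atTop (𝓝 (K * 0 + 0)) := by
        refine (Tendsto.const_mul _ ?_).add (hsumm.tendsto_atTop_zero.comp hψ.tendsto_atTop)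
        simpa only [norm_sub_rev] using tendsto_iff_norm_sub_tendsto_zero.1 hlim
      rw [mul_zero, add_zero] at h1
      refine ge_of_tendsto h1 (Eventually.of_forall fun n => ?_)
      have hs := h.sub (hφ y) (hu (ψ n))
      refine le_trans ?_ (add_le_add_left (hK _ _ hs) _)
      rw [← integral_add (h.integrable hs).abs (h.integrable (hu _))]
      refine integral_mono_ae (h.integrable (hφ y)).abs
        ((h.integrable hs).abs.add (h.integrable (hu _))) ?_
      filter_upwards [hf (ψ n)] with ω hω
      have := abs_add_le (φ y ω - f (ψ n) ω) (f (ψ n) ω)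
      rwa [sub_add_cancel, abs_of_nonneg hω] at this
    have hyz : y = 0 := by
      refine h.eq_zero (hφ y) ?_
      have := (integral_eq_zero_iff_of_nonneg (fun ω => abs_nonneg _)
        (h.integrable (hφ y)).abs).1 (le_antisymm hy0 (integral_nonneg fun _ => abs_nonneg _))
      filter_upwards [this] with ω hω
      exact abs_eq_zero.1 hω
    rw [hyz] at hlim
    obtain ⟨n, hn⟩ := ((tendsto_zero_iff_norm_tendsto_zero.1 hlim).eventually
      (gt_mem_nhds hδ)).exists
    exact absurd (huδ (ψ n)) (not_le.2 hn)

end IsFunctionSpace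

/-! ### The ℓ¹ case -/

/-- Bessel's equality for finite sums of a bounded orthonormal sequence. -/
theorem integral_sum_mul_sq_eq {Ω : Type*} [MeasurableSpace Ω] {μ : Measure Ω}
    [IsFiniteMeasure μ] {r : ℕ → Ω → ℝ} {B : ℝ} (hr : ∀ n, Measurable (r n))
    (hrB : ∀ n ω, |r n ω| ≤ B)
    (hro : ∀ m n, ∫ ω, r m ω * r n ω ∂μ = if m = n then 1 else 0) (s : Finset ℕ) (c : ℕ → ℝ) :
    ∫ ω, (∑ k ∈ s, c k * r k ω) ^ 2 ∂μ = ∑ k ∈ s, c k ^ 2 := by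
  have hi : ∀ m n, Integrable (fun ω => c m * c n * (r m ω * r n ω)) μ := fun m n => by
    refine Integrable.const_mul (Integrable.of_bound ((hr m).mul (hr n)).aestronglyMeasurable
      (B * B) (Eventually.of_forall fun ω => ?_)) _
    rw [Real.norm_eq_abs, Pi.mul_apply, abs_mul]
    exact mul_le_mul (hrB m ω) (hrB n ω) (abs_nonneg _) ((abs_nonneg _).trans (hrB m ω))
  have : ∀ ω, (∑ k ∈ s, c k * r k ω) ^ 2 = ∑ m ∈ s, ∑ n ∈ s, c m * c n * (r m ω * r n ω) := by
    intro ω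
    rw [sq, Finset.sum_mul_sum]
    exact Finset.sum_congr rfl fun m _ => Finset.sum_congr rfl fun n _ => by ring
  simp only [this]
  rw [integral_finsetSum _ fun m _ => integrable_finsetSum _ fun n _ => hi m n]
  refine Finset.sum_congr rfl fun m hm => ?_
  rw [integral_finsetSum _ fun n _ => hi m n]
  simp only [integral_const_mul, hro]
  simp [hm, sq]

/-- The `ℓ¹` norm is almost additive for vectors that are almost disjointly supported. -/
theorem le_tsum_abs_apply_add {E : Type*} [NormedAddCommGroup E] [NormedSpace ℝ E]
    (g : ℕ → E →L[ℝ] ℝ) (hg : ∀ x, Summable fun k => |g k x|) {x y : E} {N : ℕ} {τ : ℝ}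
    (hx : ∑' i, |g (i + N) x| ≤ τ) (hy : ∀ i < N, g i y = 0) :
    ∑' i, |g i x| + ∑' i, |g i y| - 2 * τ ≤ ∑' i, |g i (x + y)| := by
  have hs : ∀ z, Summable fun k => |g (k + N) z| := fun z => (summable_nat_add_iff N).2 (hg z)
  rw [← (hg x).sum_add_tsum_nat_add N, ← (hg y).sum_add_tsum_nat_add N,
    ← (hg (x + y)).sum_add_tsum_nat_add N]
  have h1 : ∑ i ∈ Finset.range N, |g i (x + y)| = ∑ i ∈ Finset.range N, |g i x| :=
    Finset.sum_congr rfl fun i hi => by rw [map_add, hy i (Finset.mem_range.1 hi), add_zero]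
  have h2 : ∑ i ∈ Finset.range N, |g i y| = 0 :=
    Finset.sum_eq_zero fun i hi => by rw [hy i (Finset.mem_range.1 hi), abs_zero]
  -- The tail of x is lost twice: once in its own norm and once when it is subtracted from the tail
  -- of y.
  have h3 : ∑' i, |g (i + N) y| - ∑' i, |g (i + N) x| ≤ ∑' i, |g (i + N) (x + y)| := by
    rw [← (hs y).tsum_sub (hs x)]
    refine ((hs y).sub (hs x)).tsum_le_tsum (fun i => ?_) (hs (x + y))
    rw [map_add]
    have := abs_sub_abs_le_abs_sub (g (i + N) y) (-g (i + N) x)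
    rwa [abs_neg, sub_neg_eq_add, add_comm (g (i + N) y)] at this
  linarith

namespace IsFunctionSpace

variable {Ω E : Type*} [MeasurableSpace Ω] {μ : Measure Ω} [NormedAddCommGroup E] [NormedSpace ℝ E]
  {R : E → (Ω → ℝ) → Prop}

open IsSolidRepresentation in
/-- If an order continuous function space admits a bounded operator to `ℓ¹` whose coordinates do
not tend to zero in norm, then it carries a strictly singular operator that is not compact. -/
theorem exists_strictlySingular_of_l1_coordinates [IsFiniteMeasure μ] [CompleteSpace E]
    (h : IsFunctionSpace μ R) (hoc : OrderContinuous R)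
    {g : ℕ → E →L[ℝ] ℝ} {C δ : ℝ} (hgC : ∀ n x, ∑ k ∈ Finset.range n, |g k x| ≤ C * ‖x‖)
    (hδ : 0 < δ) (hgδ : ∀ k, δ ≤ ‖g k‖) {r : ℕ → Ω → ℝ} {B : ℝ}
    (hr : ∀ n, Measurable (r n)) (hB : 0 < B) (hrB : ∀ n ω, |r n ω| ≤ B)
    (hro : ∀ m n, ∫ ω, r m ω * r n ω ∂μ = if m = n then 1 else 0) :
    ∃ T : E →L[ℝ] E, IsStrictlySingular T ∧ ¬ IsCompactOperator T := by
  obtain ⟨K, hK0, hK⟩ := h.exists_integral_abs_le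
  obtain ⟨e, he⟩ := h.one
  choose φ hφ using h.total
  choose w hw hwB using fun n => h.bounded he (hr n).aestronglyMeasurable hB.le
    (Eventually.of_forall (hrB n))
  have hgs : ∀ x, Summable fun k => |g k x| := fun x =>
    summable_of_sum_range_le (fun _ => abs_nonneg _) fun n => hgC n x
  have hgt : ∀ x, ∑' k, |g k x| ≤ C * ‖x‖ := fun x =>
    Real.tsum_le_of_sum_range_le (fun _ => abs_nonneg _) fun n => hgC n x
  have hg1 : ∀ k x, |g k x| ≤ ∑' i, |g i x| := fun k x =>
    (hgs x).le_tsum k fun _ _ => abs_nonneg _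
  have hle : ∀ x k, ‖g k x • w k‖ ≤ |g k x| * (B * ‖e‖) := fun x k => by
    rw [norm_smul, Real.norm_eq_abs]
    exact mul_le_mul_of_nonneg_left (hwB k) (abs_nonneg _)
  have hsum : ∀ x, Summable fun k => g k x • w k := fun x =>
    Summable.of_norm_bounded ((hgs x).mul_right _) (hle x)
  have hbound : ∀ x, ‖∑' k, g k x • w k‖ ≤ (∑' k, |g k x|) * (B * ‖e‖) := fun x => by
    rw [← tsum_mul_right]
    exact tsum_of_norm_bounded ((hgs x).mul_right _).hasSum (hle x)
  obtain ⟨T, hT⟩ : ∃ T : E →L[ℝ] E, ∀ x, T x = ∑' k, g k x • w k := by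
    let T : E →ₗ[ℝ] E :=
      { toFun := fun x => ∑' k, g k x • w k
        map_add' := fun x y => by
          rw [← (hsum x).tsum_add (hsum y)]
          simp only [map_add, add_smul]
        map_smul' := fun c x => by
          rw [RingHom.id_apply, ← (hsum x).tsum_const_smul c]
          simp only [map_smul, smul_assoc] }
    refine ⟨T.mkContinuous (C * (B * ‖e‖)) fun x => ?_, fun x => rfl⟩
    refine (hbound x).trans ?_
    calc _ ≤ C * ‖x‖ * (B * ‖e‖) := by gcongr; exact hgt x
      _ = _ := by ring
  have hTsum : ∀ x, HasSum (fun k => g k x • w k) (T x) := fun x => hT x ▸ (hsum x).hasSum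
  have hTb : ∀ x, ‖T x‖ ≤ (∑' k, |g k x|) * (B * ‖e‖) := fun x => hT x ▸ hbound x
  refine ⟨T, ?_, ?_⟩
  · rintro M hM ⟨c, hc, hcM⟩
    -- ‖T x‖ is controlled by the ℓ¹ norm of the coordinates, so a lower bound for T on M makes that
    -- ℓ¹ norm bounded below on unit vectors of M.
    obtain ⟨δ', hδ', hδ1⟩ : ∃ δ' : ℝ, 0 < δ' ∧ ∀ x ∈ M, ‖x‖ = 1 → δ' ≤ ∑' k, |g k x| := by
      refine ⟨c / (B * ‖e‖ + 1), by positivity, fun x hx hx1 => ?_⟩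
      rw [div_le_iff₀ (by positivity)]
      have h1 := (hcM x hx).trans (hTb x)
      rw [hx1, mul_one] at h1
      have h2 : 0 ≤ ∑' k, |g k x| := tsum_nonneg fun _ => abs_nonneg _
      linarith
    have hC0 : 0 ≤ C := by
      obtain ⟨x, -, hx1, -⟩ := Submodule.exists_norm_eq_one_of_not_finiteDimensional hM g 0
      simpa [hx1] using hgC 0 x
    -- Each added hump loses at most 4η ≤ δ'/2, so the ℓ¹ norm grows by δ'/2 per step; η ≤ 1 is what
    -- the coordinate bound C + 2 needs.
    set η := min (δ' / 8) 1 with hη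
    have hη0 : 0 < η := by positivity
    obtain ⟨x, N, hxM, hx1, hxN, hxQ⟩ := Submodule.exists_gliding_hump hM g
      (fun x ε N => ∑' i, |g (i + N) x| ≤ η * ε) (fun x ε hε => by
        exact ((tendsto_sum_nat_add fun i => |g i x|).eventually
          (gt_mem_nhds (show 0 < η * ε by positivity))).mono fun _ => le_of_lt)
      (fun x ε ε' N hεε hQ => hQ.trans (by gcongr))
    set y : ℕ → E := fun n => ∑ k ∈ Finset.range n, x k with hy
    have hyM : ∀ n, y n ∈ M := fun n => Submodule.sum_mem _ fun k _ => hxM k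
    have hysup : ∀ n i, |g i (y n)| ≤ C + 2 := by
      intro n i
      have := abs_apply_signedSum_le g (D := C)
        (fun i k => (hg1 i (x k)).trans (by simpa [hx1] using hgt (x k))) hxN
        (fun k j hkj i hi => ?_) n (Finset.range n) i
      · have hsg : signedSum (Finset.range n) (Finset.range n) x = y n :=
          Finset.sum_congr rfl fun k hk => if_pos hk
        rwa [hsg] at this
      · have h1 := ((summable_nat_add_iff (N j)).2 (hgs (x k))).le_tsum (i - N j)
          fun _ _ => abs_nonneg _
        rw [Nat.sub_add_cancel hi] at h1
        refine h1.trans ((hxQ k j hkj).trans ?_)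
        exact mul_le_of_le_one_left (by positivity) (min_le_right _ _)
    have hytail : ∀ n, ∑' i, |g (i + N n) (y n)| ≤ η * 2 := by
      intro n
      have hs : ∀ k, Summable fun i => |g (i + N n) (x k)| := fun k =>
        (summable_nat_add_iff (N n)).2 (hgs (x k))
      calc ∑' i, |g (i + N n) (y n)| ≤ ∑' i, ∑ k ∈ Finset.range n, |g (i + N n) (x k)| := by
            refine ((summable_nat_add_iff (N n)).2 (hgs (y n))).tsum_le_tsum (fun i => ?_)
              (summable_sum fun k _ => hs k)
            rw [hy, map_sum]
            exact Finset.abs_sum_le_sum_abs _ _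
        _ = ∑ k ∈ Finset.range n, ∑' i, |g (i + N n) (x k)| :=
            Summable.tsum_finsetSum fun k _ => hs k
        _ ≤ ∑ k ∈ Finset.range n, η * (1 / 2 : ℝ) ^ k :=
            Finset.sum_le_sum fun k hk => hxQ k n (Finset.mem_range.1 hk)
        _ = η * ∑ k ∈ Finset.range n, (1 / 2 : ℝ) ^ k := (Finset.mul_sum _ _ _).symm
        _ ≤ η * 2 := by
            gcongr
            exact (summable_geometric_two.sum_le_tsum _ fun k _ => by positivity).trans_eq
              tsum_geometric_two
    have hylow : ∀ n : ℕ, n * (δ' / 2) ≤ ∑' i, |g i (y n)| := by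
      intro n
      induction n with
      | zero => simpa using tsum_nonneg fun _ => abs_nonneg _
      | succ n ih =>
        have h1 := le_tsum_abs_apply_add g hgs (hytail n) (hxN n)
        have h2 : y (n + 1) = y n + x n := Finset.sum_range_succ _ _
        have h3 := hδ1 (x n) (hxM n) (hx1 n)
        have h4 : η ≤ δ' / 8 := min_le_left _ _
        rw [h2]
        push_cast
        linarith
    -- The tolerance c/(C + 1) will force (C + 1)‖z‖ ≤ 1, whereas ℓ¹ norm 1 requires C‖z‖ ≥ 1.
    obtain ⟨θ, hθ, hsmall⟩ := h.exists_norm_le_of_integral_sq_le hoc B hB.le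
      (show 0 < c / (C + 1) by positivity)
    obtain ⟨n, hn⟩ := exists_nat_gt ((C + 2) / θ / (δ' / 2))
    have hn' : (C + 2) / θ < ∑' i, |g i (y n)| := by
      rw [div_lt_iff₀ (by positivity)] at hn
      exact hn.trans_le (hylow n)
    set Λ := ∑' i, |g i (y n)| with hΛ
    have hΛ0 : 0 < Λ := lt_of_le_of_lt (by positivity) hn'
    have hz1 : ∀ i, |g i (Λ⁻¹ • y n)| = Λ⁻¹ * |g i (y n)| := fun i => by
      rw [map_smul, smul_eq_mul, abs_mul, abs_of_pos (inv_pos.2 hΛ0)]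
    have hzsum : ∑' i, |g i (Λ⁻¹ • y n)| = 1 := by
      simp only [hz1]
      rw [tsum_mul_left, ← hΛ, inv_mul_cancel₀ hΛ0.ne']
    -- With ℓ¹ norm 1 and coordinates at most θ, the sum of squares is at most θ, while the image
    -- functions stay bounded by B.
    have hzθ : ∀ i, |g i (Λ⁻¹ • y n)| ≤ θ := fun i => by
      rw [hz1, inv_mul_le_iff₀ hΛ0]
      rw [div_lt_iff₀ hθ] at hn'
      exact (hysup n i).trans hn'.le
    set z := Λ⁻¹ • y n with hz
    have hfin : ∀ m, ∑ i ∈ Finset.range m, |g i z| ≤ 1 := fun m =>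
      ((hgs z).sum_le_tsum _ fun _ _ => abs_nonneg _).trans_eq hzsum
    have hTz : ‖T z‖ ≤ c / (C + 1) := by
      refine le_of_tendsto (hTsum z).tendsto_sum_nat.norm (Eventually.of_forall fun m => ?_)
      refine hsmall _ _ (h.sum (Finset.range m) fun k _ => h.smul (g k z) (hw k))
        (Eventually.of_forall fun ω => ?_) ?_
      · refine (Finset.abs_sum_le_sum_abs _ _).trans ?_
        calc ∑ k ∈ Finset.range m, |g k z * r k ω| ≤ ∑ k ∈ Finset.range m, |g k z| * B :=
              Finset.sum_le_sum fun k _ => by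
                rw [abs_mul]
                exact mul_le_mul_of_nonneg_left (hrB k ω) (abs_nonneg _)
          _ = (∑ k ∈ Finset.range m, |g k z|) * B := (Finset.sum_mul _ _ _).symm
          _ ≤ 1 * B := mul_le_mul_of_nonneg_right (hfin m) hB.le
          _ = B := one_mul B
      · rw [integral_sum_mul_sq_eq hr hrB hro]
        calc ∑ k ∈ Finset.range m, g k z ^ 2 ≤ ∑ k ∈ Finset.range m, θ * |g k z| :=
              Finset.sum_le_sum fun k _ => by
                rw [← sq_abs, sq]
                exact mul_le_mul_of_nonneg_right (hzθ k) (abs_nonneg _)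
          _ = θ * ∑ k ∈ Finset.range m, |g k z| := (Finset.mul_sum _ _ _).symm
          _ ≤ θ * 1 := mul_le_mul_of_nonneg_left (hfin m) hθ.le
          _ = θ := mul_one θ
    have h1 := (hcM z (M.smul_mem _ (hyM n))).trans hTz
    have h2 := hgt z
    rw [hzsum] at h2
    rw [le_div_iff₀ (by positivity), mul_assoc] at h1
    have h3 : ‖z‖ * (C + 1) ≤ 1 := le_of_mul_le_mul_left (by rwa [mul_one]) hc
    have h4 : ‖z‖ ≤ 0 := by nlinarith
    have h5 : C * ‖z‖ ≤ 0 := mul_nonpos_of_nonneg_of_nonpos hC0 h4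
    linarith
  · intro hcomp
    choose z hz1 hzδ using fun k => (g k).exists_lt_apply_of_lt_opNorm
      (show δ / 2 < ‖g k‖ from (half_lt_self hδ).trans_le (hgδ k))
    obtain ⟨v, ψ, hψ, hlim⟩ := hcomp.exists_tendsto_subseq (C := 1) fun n => (hz1 n).le
    choose b hb using fun n =>
      h.exists_functional (hr n).aestronglyMeasurable hB.le (hrB n)
    have hbK : ∀ n x, |b n x| ≤ B * K * ‖x‖ := fun n x => by
      rw [hb n x _ (hφ x), ← Real.norm_eq_abs, mul_assoc]
      refine le_trans ?_ (mul_le_mul_of_nonneg_left (hK _ _ (hφ x)) hB.le)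
      rw [← integral_const_mul]
      refine norm_integral_le_of_norm_le ((h.integrable (hφ x)).abs.const_mul B)
        (Eventually.of_forall fun ω => ?_)
      rw [Real.norm_eq_abs, abs_mul, mul_comm]
      exact mul_le_mul_of_nonneg_right (hrB n ω) (abs_nonneg _)
    -- By orthonormality b n ∘ T = g n, with the b n uniformly bounded. If the T (z (ψ m)) were
    -- Cauchy, g (ψ m) would nearly agree on z (ψ m) and a fixed z (ψ n); but the first value
    -- exceeds δ/2 and the second tends to 0.
    have hbT : ∀ n x, b n (T x) = g n x := fun n x => by
      have hval : ∀ k, b n (w k) = if k = n then 1 else 0 := fun k => by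
        rw [hb n _ _ (hw k), hro]
      have h1 := (b n).hasSum (hTsum x)
      have h2 := hasSum_single (f := fun k => b n (g k x • w k)) n fun k hk => by
        rw [map_smul, hval, if_neg hk, smul_zero]
      simpa [hval] using h1.unique h2
    have hcs := hlim.cauchySeq
    rw [Metric.cauchySeq_iff'] at hcs
    obtain ⟨n, hn⟩ := hcs (δ / 4 / (B * K + 1)) (by positivity)
    have hg0 : Tendsto (fun m => |g (ψ m) (z (ψ n))|) atTop (𝓝 0) :=
      (hgs (z (ψ n))).tendsto_atTop_zero.comp hψ.tendsto_atTop
    obtain ⟨m, hm1, hm2⟩ := ((hg0.eventually (gt_mem_nhds (show 0 < δ / 4 by positivity))).and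
      (eventually_ge_atTop n)).exists
    have h1 := hn m hm2
    rw [dist_eq_norm, lt_div_iff₀ (by positivity)] at h1
    have h2 := hbK (ψ m) (T (z (ψ m)) - T (z (ψ n)))
    rw [map_sub, hbT, hbT] at h2
    have h3 := hzδ (ψ m)
    rw [Real.norm_eq_abs] at h3
    have h4 := abs_sub_abs_le_abs_sub (g (ψ m) (z (ψ m))) (g (ψ m) (z (ψ n)))
    have h5 := norm_nonneg (T (z (ψ m)) - T (z (ψ n)))
    linarith

end IsFunctionSpace

/-! ### The Köthe dual and reflexivity -/

/-- The functional `g` is integration against the function `b`. -/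
def DualRepresents {Ω E : Type*} [MeasurableSpace Ω] (μ : Measure Ω)
    [NormedAddCommGroup E] [NormedSpace ℝ E] (R : E → (Ω → ℝ) → Prop)
    (g : StrongDual ℝ E) (b : Ω → ℝ) : Prop :=
  AEStronglyMeasurable b μ ∧ ∀ x f, R x f →
    Integrable (fun ω => f ω * b ω) μ ∧ g x = ∫ ω, f ω * b ω ∂μ

namespace IsFunctionSpace

open IsSolidRepresentation

variable {Ω E : Type*} [MeasurableSpace Ω] {μ : Measure Ω} [NormedAddCommGroup E] [NormedSpace ℝ E]
  {R : E → (Ω → ℝ) → Prop}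

/-- Hölder's inequality for the pairing with the dual. -/
theorem integral_abs_mul_le (h : IsFunctionSpace μ R) {g : StrongDual ℝ E} {b : Ω → ℝ}
    (hg : DualRepresents μ R g b) {x : E} {f : Ω → ℝ} (hx : R x f) :
    ∫ ω, |f ω * b ω| ∂μ ≤ ‖g‖ * ‖x‖ := by
  obtain ⟨b', hb's, hbb⟩ := hg.1
  obtain ⟨s, hs, hs1, hsb⟩ := exists_measurable_sign hb's.measurable
  obtain ⟨y, hy, hyx⟩ := h.solid (g := fun ω => |f ω| * s ω) hx
    ((h.aestronglyMeasurable hx).norm.mul hs.aestronglyMeasurable) (Eventually.of_forall fun ω => by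
      rw [abs_mul, abs_abs]
      exact mul_le_of_le_one_right (abs_nonneg _) (hs1 ω))
  have : ∫ ω, |f ω * b ω| ∂μ = g y := by
    rw [(hg.2 y _ hy).2]
    refine integral_congr_ae ?_
    filter_upwards [hbb] with ω hω
    rw [abs_mul, hω, mul_assoc, hsb]
  rw [this]
  exact (le_abs_self _).trans ((g.le_opNorm y).trans (by gcongr))

/-- The functionals given by functions form a solid space of functions: the Köthe dual. -/
theorem isSolidRepresentation_dual [CompleteSpace E] (h : IsFunctionSpace μ R) :
    IsSolidRepresentation μ (DualRepresents μ R) where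
  aestronglyMeasurable hg := hg.1
  congr := fun {g b b'} hg hbb => by
    refine ⟨hg.1.congr hbb, fun x f hx => ?_⟩
    have he : (fun ω => f ω * b ω) =ᵐ[μ] fun ω => f ω * b' ω := by
      filter_upwards [hbb] with ω hω
      rw [hω]
    rw [← integrable_congr he, ← integral_congr_ae he]
    exact hg.2 x f hx
  add := fun {g g' b b'} hg hg' => by
    refine ⟨hg.1.add hg'.1, fun x f hx => ?_⟩
    obtain ⟨h1, h2⟩ := hg.2 x f hx
    obtain ⟨h3, h4⟩ := hg'.2 x f hx
    simp only [mul_add]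
    exact ⟨h1.add h3, by rw [integral_add h1 h3, add_apply, h2, h4]⟩
  smul := fun {g b} c hg => by
    refine ⟨hg.1.const_mul c, fun x f hx => ?_⟩
    obtain ⟨h1, h2⟩ := hg.2 x f hx
    simp only [mul_left_comm _ c]
    exact ⟨h1.const_mul c, by rw [integral_const_mul, smul_apply, h2,
      smul_eq_mul]⟩
  unique := fun {g g' b} hg hg' => by
    ext x
    obtain ⟨f, hf⟩ := h.total x
    rw [(hg.2 x f hf).2, (hg'.2 x f hf).2]
  solid := fun {g b b'} hg hb' hle => by
    have hi : ∀ x f, R x f → Integrable (fun ω => f ω * b' ω) μ := fun x f hx => by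
      refine (hg.2 x f hx).1.mono ((h.aestronglyMeasurable hx).mul hb') ?_
      filter_upwards [hle] with ω hω
      rw [Real.norm_eq_abs, Real.norm_eq_abs, abs_mul, abs_mul]
      exact mul_le_mul_of_nonneg_left hω (abs_nonneg _)
    obtain ⟨g', hg'n, hg'⟩ := h.exists_functional_of_abs_integral_le (norm_nonneg g) hi
      fun x f hx => by
        refine le_trans ?_ (h.integral_abs_mul_le hg hx)
        rw [← Real.norm_eq_abs]
        refine norm_integral_le_of_norm_le (hg.2 x f hx).1.abs ?_
        filter_upwards [hle] with ω hω
        rw [Real.norm_eq_abs, abs_mul, abs_mul]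
        exact mul_le_mul_of_nonneg_left hω (abs_nonneg _)
    exact ⟨g', ⟨hb', fun x f hx => ⟨hi x f hx, hg' x f hx⟩⟩, hg'n⟩
  one := by
    obtain ⟨g, hg⟩ := h.exists_functional (s := fun _ => 1) aestronglyMeasurable_const zero_le_one
      (fun _ => by simp)
    exact ⟨g, aestronglyMeasurable_const, fun x f hx =>
      ⟨by simpa using h.integrable hx, hg x f hx⟩⟩

/-- If the space has no bounded operator to `ℓ¹` whose coordinates are bounded away from zero in
norm, then the Köthe dual is order continuous. -/
theorem orderContinuous_dual [CompleteSpace E] (h : IsFunctionSpace μ R)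
    (hno : ¬ ∃ (g : ℕ → E →L[ℝ] ℝ) (C δ : ℝ), 0 < δ ∧ (∀ k, δ ≤ ‖g k‖) ∧
      ∀ n x, ∑ k ∈ Finset.range n, |g k x| ≤ C * ‖x‖) :
    OrderContinuous (DualRepresents μ R) := by
  intro g b hg A hA hAa hAe p hp
  have hD := h.isSolidRepresentation_dual
  have hanti : Antitone fun n => ‖p n‖ := fun m n hmn =>
    hD.norm_mono (hp n) (hp m) (Eventually.of_forall fun ω => by
      by_cases hn : ω ∈ A n
      · simp [hn, hAa hmn hn]
      · simp [hn])
  by_contra hcon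
  obtain ⟨δ, hδ, hpδ⟩ : ∃ δ : ℝ, 0 < δ ∧ ∀ n, δ ≤ ‖p n‖ := by
    by_contra! hc
    refine hcon (Metric.tendsto_atTop.2 fun ε hε => ?_)
    obtain ⟨n, hn⟩ := hc ε hε
    refine ⟨n, fun m hm => ?_⟩
    rw [Real.dist_eq, sub_zero, abs_norm]
    exact (hanti hm).trans_lt hn
  have hval : ∀ n x f, R x f → p n x = ∫ ω in A n, f ω * b ω ∂μ := fun n x f hx => by
    rw [((hp n).2 x f hx).2, ← integral_indicator (hA n)]
    congr 1
    ext ω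
    by_cases hω : ω ∈ A n <;> simp [hω]
  -- The p m tend to 0 pointwise on E but not in norm: on a vector almost norming p n, p m drops
  -- below δ/4 for large m, so the difference keeps norm at least δ/4.
  have hstep : ∀ n, ∃ m, n ≤ m ∧ δ / 4 ≤ ‖p n - p m‖ := by
    intro n
    obtain ⟨x, hx1, hx⟩ := (p n).exists_lt_apply_of_lt_opNorm
      (show δ / 2 < ‖p n‖ from (half_lt_self hδ).trans_le (hpδ n))
    obtain ⟨f, hf⟩ := h.total x
    have hlim : Tendsto (fun m => p m x) atTop (𝓝 0) := by
      have := tendsto_setIntegral_of_antitone hA hAa ⟨0, (hg.2 x f hf).1.integrableOn⟩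
      rw [hAe, setIntegral_empty] at this
      simpa only [hval _ x f hf] using this
    obtain ⟨m, hm, hnm⟩ := ((Metric.tendsto_nhds.1 hlim (δ / 4) (by positivity)).and
      (eventually_ge_atTop n)).exists
    refine ⟨m, hnm, ?_⟩
    rw [Real.dist_eq, sub_zero] at hm
    rw [Real.norm_eq_abs] at hx
    have h1 := (p n - p m).le_opNorm x
    rw [sub_apply, Real.norm_eq_abs] at h1
    have h2 := abs_sub_abs_le_abs_sub (p n x) (p m x)
    have h3 : ‖p n - p m‖ * ‖x‖ ≤ ‖p n - p m‖ := mul_le_of_le_one_right (norm_nonneg _) hx1.le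
    linarith
  choose s hs hsδ using hstep
  let t : ℕ → ℕ := fun n => s^[n] 0
  have ht : ∀ n, t (n + 1) = s (t n) := fun n => Function.iterate_succ_apply' s n 0
  -- Successive differences integrate against b over disjoint sets, so the sum of their absolute
  -- values at x telescopes to at most ∫ |f b| ≤ ‖g‖‖x‖: the excluded ℓ¹ coordinates.
  refine hno ⟨fun k => p (t k) - p (t (k + 1)), ‖g‖, δ / 4, by positivity,
    fun k => by simpa only [ht] using hsδ (t k), fun n x => ?_⟩
  obtain ⟨f, hf⟩ := h.total x
  have hfi := (hg.2 x f hf).1.abs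
  have hk : ∀ k, |(p (t k) - p (t (k + 1))) x| ≤
      ∫ ω in A (t k), |f ω * b ω| ∂μ - ∫ ω in A (t (k + 1)), |f ω * b ω| ∂μ := by
    intro k
    have hsub : A (t (k + 1)) ⊆ A (t k) := hAa (by rw [ht]; exact hs _)
    rw [sub_apply, hval _ x f hf, hval _ x f hf,
      ← setIntegral_sdiff (hA _) (hg.2 x f hf).1.integrableOn hsub,
      ← setIntegral_sdiff (hA _) hfi.integrableOn hsub]
    exact abs_integral_le_integral_abs
  calc ∑ k ∈ Finset.range n, |(p (t k) - p (t (k + 1))) x|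
      ≤ ∑ k ∈ Finset.range n,
        (∫ ω in A (t k), |f ω * b ω| ∂μ - ∫ ω in A (t (k + 1)), |f ω * b ω| ∂μ) :=
        Finset.sum_le_sum fun k _ => hk k
    _ = ∫ ω in A (t 0), |f ω * b ω| ∂μ - ∫ ω in A (t n), |f ω * b ω| ∂μ :=
        Finset.sum_range_sub' (fun k => ∫ ω in A (t k), |f ω * b ω| ∂μ) n
    _ ≤ ∫ ω in A (t 0), |f ω * b ω| ∂μ :=
        sub_le_self _ (integral_nonneg fun _ => abs_nonneg _)
    _ ≤ ∫ ω, |f ω * b ω| ∂μ :=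
        setIntegral_le_integral hfi (Eventually.of_forall fun _ => abs_nonneg _)
    _ ≤ ‖g‖ * ‖x‖ := h.integral_abs_mul_le hg hf

/-- A function space without the two obstructions, a positive `c₀`-like sequence and an
`ℓ¹`-valued operator, is reflexive. -/
theorem isReflexiveSpace [IsFiniteMeasure μ] [CompleteSpace E] (h : IsFunctionSpace μ R)
    (hpos : ¬ HasBoundedPositiveSeries μ R)
    (hno : ¬ ∃ (g : ℕ → E →L[ℝ] ℝ) (C δ : ℝ), 0 < δ ∧ (∀ k, δ ≤ ‖g k‖) ∧
      ∀ n x, ∑ k ∈ Finset.range n, |g k x| ≤ C * ‖x‖) : IsReflexiveSpace E := by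
  have hD := h.isSolidRepresentation_dual
  have hrep : ∀ g : StrongDual ℝ E, ∃ b, DualRepresents μ R g b := fun g => by
    obtain ⟨b, hbm, -, hb⟩ := h.exists_density (h.orderContinuous hpos) g
    exact ⟨b, hbm.aestronglyMeasurable, hb⟩
  intro F
  obtain ⟨k, hkm, -, hk⟩ := hD.exists_density (h.orderContinuous_dual hno) F
  obtain ⟨A, hA, hAa, hAe, hAk⟩ := exists_antitone_bounded_off hkm
  obtain ⟨s, hs, hs1, hsk⟩ := exists_measurable_sign hkm
  obtain ⟨e, he⟩ := h.one
  set q : ℕ → Ω → ℝ := fun n => (A n)ᶜ.indicator fun ω => |k ω| with hq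
  have hq0 : ∀ n ω, 0 ≤ q n ω := fun n ω => Set.indicator_nonneg (fun _ _ => abs_nonneg _) _
  choose v hv _ using fun n => h.bounded (f := q n) he
    (hkm.abs.indicator (hA n).compl).aestronglyMeasurable (Nat.cast_nonneg n)
    (Eventually.of_forall fun ω => by
      by_cases hω : ω ∈ A n
      · simp [hq, hω]
      · simpa [hq, hω] using hAk n ω hω)
  -- Take a norming functional with density b for v n. Multiplied by sgn k and cut off from A n, it
  -- has norm at most 1, and F takes the value ‖v n‖ on it.
  have hvF : ∀ n, ‖v n‖ ≤ ‖F‖ := by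
    intro n
    obtain ⟨g, hg1, hgv⟩ := exists_dual_vector'' ℝ (v n)
    obtain ⟨b, hb⟩ := hrep g
    obtain ⟨g', hg', hgg⟩ := hD.solid (g := (A n)ᶜ.indicator fun ω => s ω * b ω) hb
      ((hs.aestronglyMeasurable.mul hb.1).indicator (hA n).compl)
      (Eventually.of_forall fun ω => by
        by_cases hω : ω ∈ A n
        · simp [hω]
        · rw [Set.indicator_of_mem (show ω ∈ (A n)ᶜ from hω), abs_mul]
          exact mul_le_of_le_one_left (abs_nonneg _) (hs1 ω))
    have hFg : F g' = ‖v n‖ := by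
      rw [(hk g' _ hg').2]
      have h1 := (hb.2 _ _ (hv n)).2
      rw [hgv] at h1
      rw [RCLike.ofReal_real_eq_id, id] at h1
      rw [h1]
      congr 1
      ext ω
      by_cases hω : ω ∈ A n
      · simp [hq, hω]
      · simp only [hq, Set.indicator_of_mem (show ω ∈ (A n)ᶜ from hω), ← hsk]
        ring
    rw [← hFg]
    refine (le_abs_self _).trans ((F.le_opNorm g').trans ?_)
    exact mul_le_of_le_one_right (norm_nonneg _) (hgg.trans hg1)
  have hmono : ∀ m n, m ≤ n → ∀ᵐ ω ∂μ, q m ω ≤ q n ω := by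
    intro m n hmn
    refine Eventually.of_forall fun ω => ?_
    exact Set.indicator_le_indicator_of_subset (Set.compl_subset_compl.2 (hAa hmn))
      (fun _ => abs_nonneg _) ω
  obtain ⟨z, hz⟩ := cauchySeq_tendsto_of_complete (h.cauchySeq_of_monotone hpos hv hmono hvF)
  obtain ⟨ζ, hζ⟩ := h.total z
  have hkζ : ∀ᵐ ω ∂μ, |k ω| ≤ |ζ ω| := by
    filter_upwards [ae_all_iff.2 fun n => h.le_of_tendsto_of_monotone hv hmono hζ hz n] with ω hω
    have : ω ∉ ⋂ n, A n := by rw [hAe]; simp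
    simp only [Set.mem_iInter, not_forall] at this
    obtain ⟨n, hn⟩ := this
    have h1 := hω n
    simp only [hq, Set.indicator_of_mem (show ω ∈ (A n)ᶜ from hn)] at h1
    exact h1.trans (le_abs_self _)
  obtain ⟨x, hx, -⟩ := h.solid hζ hkm.aestronglyMeasurable hkζ
  refine ⟨x, ?_⟩
  ext g
  obtain ⟨b, hb⟩ := hrep g
  rw [NormedSpace.dual_def, (hb.2 x k hx).2, (hk g b hb).2]
  simp only [mul_comm]

end IsFunctionSpace

/-! ### The cosine system -/

/-- The `n`-th function of the normalised cosine system on the unit interval. -/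
noncomputable def cosineSystem (n : ℕ) (ω : unitInterval) : ℝ :=
  √2 * Real.cos (2 * Real.pi * ((n + 1 : ℕ) : ℝ) * ω)

theorem measurable_cosineSystem (n : ℕ) : Measurable (cosineSystem n) := by
  unfold cosineSystem
  fun_prop

theorem abs_cosineSystem_le (n : ℕ) (ω : unitInterval) : |cosineSystem n ω| ≤ √2 := by
  rw [cosineSystem, abs_mul, abs_of_nonneg (Real.sqrt_nonneg 2)]
  exact mul_le_of_le_one_right (Real.sqrt_nonneg 2) (Real.abs_cos_le_one _)

theorem unitInterval.integral_comp_coe {V : Type*} [NormedAddCommGroup V] [NormedSpace ℝ V]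
    (f : ℝ → V) : ∫ ω : unitInterval, f ω = ∫ t in (0 : ℝ)..1, f t := by
  rw [unitInterval.measurePreserving_coe.integral_comp unitInterval.measurableEmbedding_coe f,
    intervalIntegral.integral_of_le zero_le_one, ← integral_Icc_eq_integral_Ioc]

theorem integral_cos_two_pi_mul_int (m : ℤ) :
    ∫ t in (0 : ℝ)..1, Real.cos (2 * Real.pi * m * t) = if m = 0 then 1 else 0 := by
  split_ifs with hm
  · simp [hm]
  · have hc : 2 * Real.pi * (m : ℝ) ≠ 0 := by
      have : (m : ℝ) ≠ 0 := by exact_mod_cast hm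
      positivity
    rw [intervalIntegral.integral_comp_mul_left (fun t => Real.cos t) hc, integral_cos]
    have : Real.sin (2 * Real.pi * m * 1) = 0 := by
      have := Real.sin_int_mul_pi (2 * m)
      push_cast at this
      rw [← this]
      ring_nf
    rw [this]
    simp

/-- Product to sum: the frequency m + n + 2 never vanishes, because the system starts at frequency
1, and m - n vanishes only on the diagonal. -/
theorem integral_cosineSystem_mul (m n : ℕ) :
    ∫ ω, cosineSystem m ω * cosineSystem n ω = if m = n then 1 else 0 := by
  have hpt : ∀ t : ℝ, √2 * Real.cos (2 * Real.pi * ((m + 1 : ℕ) : ℝ) * t) *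
      (√2 * Real.cos (2 * Real.pi * ((n + 1 : ℕ) : ℝ) * t)) =
      Real.cos (2 * Real.pi * ((m + n + 2 : ℤ) : ℝ) * t) +
        Real.cos (2 * Real.pi * ((m - n : ℤ) : ℝ) * t) := by
    intro t
    have h2 : √2 * √2 = (2 : ℝ) := Real.mul_self_sqrt (by norm_num)
    set x := 2 * Real.pi * ((m + 1 : ℕ) : ℝ) * t with hx
    set y := 2 * Real.pi * ((n + 1 : ℕ) : ℝ) * t with hy
    have e1 : 2 * Real.pi * ((m + n + 2 : ℤ) : ℝ) * t = x + y := by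
      rw [hx, hy]; push_cast; ring
    have e2 : 2 * Real.pi * ((m - n : ℤ) : ℝ) * t = x - y := by
      rw [hx, hy]; push_cast; ring
    rw [e1, e2, Real.cos_add, Real.cos_sub]
    linear_combination Real.cos x * Real.cos y * h2
  unfold cosineSystem
  rw [unitInterval.integral_comp_coe (fun t => √2 * Real.cos (2 * Real.pi * ((m + 1 : ℕ) : ℝ) * t) *
      (√2 * Real.cos (2 * Real.pi * ((n + 1 : ℕ) : ℝ) * t)))]
  simp only [hpt]
  rw [intervalIntegral.integral_add (Continuous.intervalIntegrable (by fun_prop) _ _)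
    (Continuous.intervalIntegrable (by fun_prop) _ _), integral_cos_two_pi_mul_int,
    integral_cos_two_pi_mul_int, if_neg (by omega), zero_add]
  exact if_congr (by omega) rfl rfl

/-- The Riemann-Lebesgue lemma for the cosine system. -/
theorem tendsto_integral_mul_cosineSystem {f : unitInterval → ℝ} (hf : Integrable f) :
    Tendsto (fun n => ∫ ω, f ω * cosineSystem n ω) atTop (𝓝 0) := by
  -- Extend f by zero to ℝ; the projection only makes f evaluable at real points. The coefficients
  -- are then √2 times real parts of the Fourier transform at n + 1.
  let F : ℝ → ℂ := (Set.Icc (0 : ℝ) 1).indicator fun t =>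
    (f (Set.projIcc 0 1 zero_le_one t) : ℂ)
  have hw : Tendsto (fun n : ℕ => ((n + 1 : ℕ) : ℝ)) atTop (cocompact ℝ) :=
    ((tendsto_natCast_atTop_atTop (R := ℝ)).comp (tendsto_add_atTop_nat 1)).mono_right
      atTop_le_cocompact
  have hRL := (Real.tendsto_integral_exp_smul_cocompact F).comp hw
  have hF : ∀ w : ℝ, ∫ v : ℝ, Real.fourierChar (-(v * w)) • F v =
      ∫ ω : unitInterval, Real.fourierChar (-((ω : ℝ) * w)) • (f ω : ℂ) := by
    intro w
    have h1 : ∀ v : ℝ, Real.fourierChar (-(v * w)) • F v = (Set.Icc (0 : ℝ) 1).indicator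
        (fun t => Real.fourierChar (-(t * w)) • (f (Set.projIcc 0 1 zero_le_one t) : ℂ)) v := by
      intro v
      by_cases hv : v ∈ Set.Icc (0 : ℝ) 1 <;> simp [F, hv]
    simp only [h1]
    rw [integral_indicator measurableSet_Icc, ← integral_subtype measurableSet_Icc]
    congr 1
    ext ω
    rw [Set.projIcc_val]
  have hre : ∀ w : ℝ, (∫ ω : unitInterval, Real.fourierChar (-((ω : ℝ) * w)) • (f ω : ℂ)).re =
      ∫ ω : unitInterval, f ω * Real.cos (2 * Real.pi * w * ω) := by
    intro w
    have hi : Integrable fun ω : unitInterval =>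
        Real.fourierChar (-((ω : ℝ) * w)) • (f ω : ℂ) := by
      have hfC : Integrable fun ω : unitInterval => (f ω : ℂ) := hf.ofReal
      refine Integrable.mono hf ?_ (Eventually.of_forall fun ω => by simp)
      have : Continuous fun ω : unitInterval => Real.fourierChar (-((ω : ℝ) * w)) := by
        fun_prop
      exact this.aestronglyMeasurable.smul hfC.aestronglyMeasurable
    have := integral_re hi
    rw [show (∫ ω : unitInterval, Real.fourierChar (-((ω : ℝ) * w)) • (f ω : ℂ)).re =
      RCLike.re (∫ ω : unitInterval, Real.fourierChar (-((ω : ℝ) * w)) • (f ω : ℂ)) from rfl,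
      ← this]
    congr 1
    ext ω
    rw [Circle.smul_def, Real.fourierChar_apply, smul_eq_mul]
    simp only [RCLike.re_to_complex, Complex.re_mul_ofReal]
    rw [Complex.exp_ofReal_mul_I_re, mul_comm, ← Real.cos_neg]
    congr 2
    ring
  have hlim := ((Complex.continuous_re.tendsto _).comp hRL).const_mul √2
  rw [Complex.zero_re, mul_zero] at hlim
  refine hlim.congr fun n => ?_
  simp only [Function.comp_apply, hF, hre]
  rw [← integral_const_mul]
  congr 1
  ext ω
  rw [cosineSystem]
  ring

/-! ### Application to the unit interval -/

/-- An ideal space of integrable functions containing the constants is a function space. -/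
theorem IsRIFunctionSpace.isFunctionSpace {E : Type*} [NormedAddCommGroup E] [NormedSpace ℝ E]
    {ι : E →ₗ[ℝ] (unitInterval →ₘ[(volume : Measure unitInterval)] ℝ)}
    (hE : IsRIFunctionSpace ι) : IsFunctionSpace volume fun x f => ι x =ᵐ[volume] f where
  aestronglyMeasurable hx := (ι _).aestronglyMeasurable.congr hx
  congr hx hfg := hx.trans hfg
  add := fun {x y f g} hx hy => by
    rw [map_add]
    filter_upwards [AEEqFun.coeFn_add (ι x) (ι y), hx, hy] with ω h1 h2 h3
    rw [h1, Pi.add_apply, h2, h3]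
  smul := fun {x f} c hx => by
    rw [map_smul]
    filter_upwards [AEEqFun.coeFn_smul c (ι x), hx] with ω h1 h2
    rw [h1, Pi.smul_apply, h2, smul_eq_mul]
  unique hx hy := hE.injective (AEEqFun.ext (hx.trans hy.symm))
  solid := fun {x f g} hx hg hle => by
    obtain ⟨y, hy, hyx⟩ := hE.ideal x (AEEqFun.mk g hg) (by
      filter_upwards [AEEqFun.coeFn_mk g hg, hx, hle] with ω h1 h2 h3
      rwa [h1, h2])
    exact ⟨y, by rw [hy]; exact AEEqFun.coeFn_mk g hg, hyx⟩
  one := by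
    obtain ⟨e, he⟩ := hE.indicator_mem Set.univ MeasurableSet.univ
    exact ⟨e, by simpa using he⟩
  total x := ⟨ι x, ae_eq_refl _⟩
  integrable hx := (hE.integrable _).congr hx
  ae_eq hx hy := hx.symm.trans hy

theorem mainTheorem12 {E : Type*} [NormedAddCommGroup E] [NormedSpace ℝ E] [CompleteSpace E]
    (ι : E →ₗ[ℝ] (unitInterval →ₘ[(volume : Measure unitInterval)] ℝ))
    (hE : IsRIFunctionSpace ι) (hrefl : ¬ IsReflexiveSpace E) :
    ¬ HasKatoProperty E ∧ ∃ T : E →L[ℝ] E, IsStrictlySingular T ∧ ¬ IsCompactOperator T := by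
  have h := hE.isFunctionSpace
  have hT : ∃ T : E →L[ℝ] E, IsStrictlySingular T ∧ ¬ IsCompactOperator T := by
    by_cases hpos : HasBoundedPositiveSeries volume fun x f => ι x =ᵐ[volume] f
    · exact h.exists_strictlySingular_of_positive_series hpos measurable_cosineSystem
        (by positivity) abs_cosineSystem_le integral_cosineSystem_mul
        fun f hf => tendsto_integral_mul_cosineSystem hf
    · by_contra hcon
      -- Failure of the c₀ case supplies the order continuity needed in the ℓ¹ case; excluding both
      -- would make E reflexive.
      refine hrefl (h.isReflexiveSpace hpos ?_)
      rintro ⟨g, C, δ, hδ, hgδ, hgC⟩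
      exact hcon (h.exists_strictlySingular_of_l1_coordinates (h.orderContinuous hpos) hgC hδ hgδ
        measurable_cosineSystem (by positivity) abs_cosineSystem_le integral_cosineSystem_mul)
  refine ⟨fun hK => ?_, hT⟩
  obtain ⟨T, hTs, hTc⟩ := hT
  have hmem : T ∈ {T : E →L[ℝ] E | IsStrictlySingular T} := hTs
  rw [hK] at hmem
  exact hTc hmem
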